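/- Let $\mu>0$ and $\lambda>-2\mu/3$ (Lamé constants), $R>0$, and fix $k_0>0$. For $k>0$ put $k_1=k/\sqrt{\lambda+2\mu}$, $k_2=k/\sqrt{\mu}$, and let the Kupradze matrix $G_k(x)\in\mathbb C^{3\times 3}$, $x\in\mathbb R^3\setminus\{0\}$, $r=|x|$, be $$(G_k(x))_{ij}=\frac{1}{4\pi\mu}\left(\delta_{ij}\frac{e^{\mathbf i k_2 r}}{r}+\frac{1}{k_2^2}\,\frac{\partial^2}{\partial x_i\partial x_j}\left(\frac{e^{\mathbf i k_2 r}}{r}-\frac{e^{\mathbf i k_1 r}}{r}\right)\right),\qquad i,j=1,2,3.$$ For an open set $\Omega\subset\mathbb R^3$ contained in the open ball $B_R(0)$ (for instance a bounded connected Lipschitz domain) and $f\in L^2(\Omega)^3$ (complex-valued), the elastodynamic Newton potential is $$(N_kf)_i(x)=\sum_{j=1}^3\int_\Omega (G_k(x-y))_{ij}\,f_j(y)\,dy,\qquad x\in\Omega,\ i=1,2,3.$$ There is a constant $C>0$ depending only on $R,\mu,\lambda$ and the lower bound $k_0$ such that, for all such $\Omega$, all $k\ge k_0$ and all $f\in L^2(\Omega)^3$,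 the integrals defining $N_kf(x)$ converge absolutely for every $x\in\Omega$, $N_kf\in H^2(\Omega)^3$, and $$k^{-1}\|N_kf\|_{H^2(\Omega)}+\|N_kf\|_{H^1(\Omega)}+k\|N_kf\|_{L^2(\Omega)}\le C\,\|f\|_{L^2(\Omega)}.$$ Here $\|u\|_{H^m(\Omega)}^2=\sum_{|\alpha|\le m}\|\partial^\alpha u\|_{L^2(\Omega)}^2$ with weak derivatives $\partial^\alpha u$. -/

import Mathlib

open MeasureTheory Finset
open scoped ENNReal ContDiff

noncomputable section

namespace Elastodynamics

/-- Three-dimensional Euclidean space. -/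
abbrev E3 : Type := EuclideanSpace ℝ (Fin 3)

/-- The value space of complex vector fields, with its Hermitian norm. -/
abbrev C3 : Type := EuclideanSpace ℂ (Fin 3)

/-- The classical partial derivative of `u` with respect to the `i`-th coordinate. -/
def partialDeriv {F : Type*} [NormedAddCommGroup F] [NormedSpace ℝ F]
    (i : Fin 3) (u : E3 → F) : E3 → F :=
  fun x => fderiv ℝ u x (EuclideanSpace.single i (1 : ℝ))

/-- The iterated classical partial derivative `∂^α φ` for a multi-index `α`. -/
def multiDeriv {F : Type*} [NormedAddCommGroup F] [NormedSpace ℝ F]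
    (α : Fin 3 → ℕ) (φ : E3 → F) : E3 → F :=
  (partialDeriv 0)^[α 0] ((partialDeriv 1)^[α 1] ((partialDeriv 2)^[α 2] φ))

/-- `v` is the weak derivative `∂^α u` on `Ω`: both are locally integrable on `Ω` and
`∫ u ∂^α φ = (-1)^|α| ∫ v φ` for all smooth `φ` with compact support in `Ω`. -/
def HasWeakDeriv (Ω : Set E3) (α : Fin 3 → ℕ) (u v : E3 → C3) : Prop :=
  LocallyIntegrableOn u Ω ∧ LocallyIntegrableOn v Ω ∧
    ∀ φ : E3 → ℝ, ContDiff ℝ ∞ φ → HasCompactSupport φ → tsupport φ ⊆ Ω →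
      ∫ x in Ω, multiDeriv α φ x • u x = (-1 : ℝ) ^ (∑ i, α i) • ∫ x in Ω, φ x • v x

/-- `u` lies in `H^m(Ω)³`: it has square integrable weak derivatives of all orders up to `m`. -/
def MemSobolev (m : ℕ) (Ω : Set E3) (u : E3 → C3) : Prop :=
  ∀ α : Fin 3 → ℕ, ∑ i, α i ≤ m →
    ∃ v : E3 → C3, HasWeakDeriv Ω α u v ∧ MemLp v 2 (volume.restrict Ω)

/-- The norm `‖∂^α u‖_{L²(Ω)}` of the weak derivative, which is `∞` if there is no weak
derivative. The infimum only selects the weak derivative: for open `Ω` it is unique up to null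
sets, see `HasWeakDeriv.weakDerivNorm_eq`. -/
def weakDerivNorm (Ω : Set E3) (α : Fin 3 → ℕ) (u : E3 → C3) : ℝ≥0∞ :=
  ⨅ (v : E3 → C3) (_ : HasWeakDeriv Ω α u v), eLpNorm v 2 (volume.restrict Ω)

/-- The norm `‖u‖_{H^m(Ω)} = (∑_{|α| ≤ m} ‖∂^α u‖²_{L²(Ω)})^{1/2}`. -/
def sobolevNorm (m : ℕ) (Ω : Set E3) (u : E3 → C3) : ℝ≥0∞ :=
  (∑ n ∈ Finset.range (m + 1), ∑ α ∈ Finset.Nat.antidiagonalTuple 3 n,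
    weakDerivNorm Ω α u ^ 2) ^ (1 / 2 : ℝ)

theorem HasWeakDeriv.ae_eq {Ω : Set E3} (hΩ : IsOpen Ω) {α : Fin 3 → ℕ} {u v w : E3 → C3}
    (hv : HasWeakDeriv Ω α u v) (hw : HasWeakDeriv Ω α u w) :
    v =ᵐ[volume.restrict Ω] w := by
  have key := hΩ.ae_eq_zero_of_integral_contDiff_smul_eq_zero
    (hv.2.1.sub hw.2.1) (fun φ h1 h2 h3 => by
      have e := (hv.2.2 φ h1 h2 h3).symm.trans (hw.2.2 φ h1 h2 h3)
      have e' : ∫ x in Ω, φ x • v x = ∫ x in Ω, φ x • w x :=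
        (smul_right_injective C3 (pow_ne_zero _ (by norm_num : (-1 : ℝ) ≠ 0))) e
      have hint : ∀ z : E3 → C3, LocallyIntegrableOn z Ω →
          Integrable (fun x => φ x • z x) (volume.restrict Ω) := fun z hz => by
        have h4 : IntegrableOn (fun x => φ x • z x) (tsupport φ) :=
          (hz.integrableOn_compact_subset h3 h2.isCompact).continuousOn_smul
            h1.continuous.continuousOn h2.isCompact
        exact h4.of_forall_sdiff_eq_zero hΩ.measurableSet fun x hx => by
          rw [image_eq_zero_of_notMem_tsupport hx.2, zero_smul]
      have hz : ∀ x, x ∉ Ω → φ x • (v - w) x = 0 := fun x hx => by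
        rw [image_eq_zero_of_notMem_tsupport (fun h => hx (h3 h)), zero_smul]
      rw [← setIntegral_eq_integral_of_forall_compl_eq_zero hz]
      simp only [Pi.sub_apply, smul_sub]
      rw [integral_sub (hint v hv.2.1) (hint w hw.2.1), e', sub_self])
  rw [Filter.EventuallyEq, ae_restrict_iff' hΩ.measurableSet]
  filter_upwards [key] with x hx hxΩ
  exact sub_eq_zero.mp (hx hxΩ)

theorem HasWeakDeriv.weakDerivNorm_eq {Ω : Set E3} (hΩ : IsOpen Ω) {α : Fin 3 → ℕ}
    {u v : E3 → C3} (hv : HasWeakDeriv Ω α u v) :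
    weakDerivNorm Ω α u = eLpNorm v 2 (volume.restrict Ω) := by
  refine le_antisymm (iInf₂_le v hv) (le_iInf₂ fun w hw => ?_)
  exact (eLpNorm_congr_ae (hv.ae_eq hΩ hw)).le

/-- The outgoing spherical wave `e^{iκr}/r` with `r = |x|`. -/
def sphericalWave (κ : ℝ) (x : E3) : ℂ :=
  Complex.exp (Complex.I * κ * ‖x‖) / ‖x‖

/-- The Kupradze matrix `G_k(x)`, `x ≠ 0`, with `k₁² = k²/(λ + 2μ)`, `k₂² = k²/μ` and entries
`(1/(4πμ)) (δ_ij e^{i k₂ r}/r + k₂⁻² ∂_i ∂_j (e^{i k₂ r}/r - e^{i k₁ r}/r))`, `r = |x|`. -/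
def kupradzeMatrix (lam μ k : ℝ) (x : E3) : Matrix (Fin 3) (Fin 3) ℂ :=
  let k₁ : ℝ := k / √(lam + 2 * μ)
  let k₂ : ℝ := k / √μ
  Matrix.of fun i j =>
    1 / (4 * Real.pi * μ : ℂ) *
      ((if i = j then sphericalWave k₂ x else 0) +
        1 / (k₂ : ℂ) ^ 2 *
          partialDeriv i (partialDeriv j (fun y => sphericalWave k₂ y - sphericalWave k₁ y)) x)

/-- The Newton potential
`(N_k f)(x)_i = ∑_j ∫_Ω G_k(x - y)_ij f_j(y) dy`. -/
def newtonPotential (lam μ k : ℝ) (Ω : Set E3) (f : E3 → C3) (x : E3) : C3 :=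
  WithLp.toLp 2 fun i => ∑ j, ∫ y in Ω, kupradzeMatrix lam μ k (x - y) i j * f y j

end Elastodynamics

end

/-!
The potential is a Fourier multiplier once the kernel has been cut off. Two points of `Ω` are less
than `2R` apart, so on `Ω × Ω` the Kupradze matrix may be replaced by the compactly supported
`truncKernel`, in which both spherical waves carry a factor `η(|x|)` with `η = 1` on `[0, 2R]`
(`kupradzeMatrix_eq_truncKernel`). The truncated entries `K` are `O(1/|x|)`, hence lie in
`L¹ ∩ L²`: this gives the absolute convergence of the integrals and `N_k f = K ⋆ f` on `Ω`. By
Plancherel's theorem `∂^α (K ⋆ f)` then exists in `L²` with norm at most `M ‖f‖` as soon as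
`(2π|ξ|)^|α| |K̂(ξ)| ≤ M` (`exists_weakDeriv_convolution`), and the theorem reduces to the bound
`(2π|ξ|)^m |K̂(ξ)| ≤ C k^(m-1)` for `m = 0, 1, 2` (`exists_fourier_truncKernel_bound`).

In dimension three the Fourier transform of `h(|x|)/|x|` is the sine transform
`(4π/σ) ∫ sin(σr) h(r) dr` with `σ = 2π|ξ|` (`fourier_radial`; integration over the planes
orthogonal to `ξ` is elementary because of the factor `1/|x|`). For the scalar part
`h(r) = η(r) e^{iκ₂r}` the three bounds come from one integration by parts, against the exponential
for `m = 0` and against the sine for `m = 2`, and from the trivial estimate for `m = 1`. The part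
with second derivatives has the symbol `-(2π)² ξᵢξⱼ κ₂⁻²` times the transform of the difference of
the two waves, so up to four powers of `σ` have to be absorbed; as
`h(r) = η(r) (e^{iκ₂r} - e^{iκ₁r})` vanishes at `r = 0`, repeated integration by parts bounds
`σ^(m+1)` times its sine transform by `C k^(m+1)` (`pow_mul_norm_sine_integral_le`), which suffices
after division by `κ₂²`.

That the pointwise second derivatives of the truncated difference have this Fourier transform
despite the singularity at the origin follows by replacing `|x|` with `√(|x|² + t)` and letting
`t → 0`; the second derivatives stay dominated by a multiple of `1/|x|` (`fourier_radialHessian`).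
-/

noncomputable section

namespace Elastodynamics

open scoped FourierTransform LineDeriv SchwartzMap Convolution

/-! ### Weak derivatives of convolutions by Plancherel's theorem -/

theorem partialDeriv_ofReal {φ : E3 → ℝ} (hφ : ContDiff ℝ ∞ φ) (i : Fin 3) :
    partialDeriv i (fun x => (φ x : ℂ)) = fun x => ((partialDeriv i φ x : ℝ) : ℂ) := by
  funext x
  have h := (hφ.differentiable (by simp)) x
  have h2 : HasFDerivAt (fun x => (φ x : ℂ)) (Complex.ofRealCLM.comp (fderiv ℝ φ x)) x :=
    (Complex.ofRealCLM.hasFDerivAt).comp x h.hasFDerivAt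
  simp [partialDeriv, h2.fderiv]

theorem contDiff_partialDeriv {φ : E3 → ℝ} (hφ : ContDiff ℝ ∞ φ) (i : Fin 3) :
    ContDiff ℝ ∞ (partialDeriv i φ) := by
  unfold partialDeriv
  exact (hφ.fderiv_right (m := ∞) (by simp)).clm_apply contDiff_const

theorem contDiff_iterate_partialDeriv {φ : E3 → ℝ} (hφ : ContDiff ℝ ∞ φ) (i : Fin 3) (n : ℕ) :
    ContDiff ℝ ∞ ((partialDeriv i)^[n] φ) := by
  induction n with
  | zero => exact hφ
  | succ n ih =>
    rw [Function.iterate_succ_apply']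
    exact contDiff_partialDeriv ih i

theorem iterate_partialDeriv_ofReal {φ : E3 → ℝ} (hφ : ContDiff ℝ ∞ φ) (i : Fin 3) (n : ℕ) :
    (partialDeriv i)^[n] (fun x => (φ x : ℂ)) = fun x => (((partialDeriv i)^[n] φ x : ℝ) : ℂ) := by
  induction n with
  | zero => rfl
  | succ n ih =>
    rw [Function.iterate_succ_apply', Function.iterate_succ_apply', ih,
      partialDeriv_ofReal (contDiff_iterate_partialDeriv hφ i n)]

theorem multiDeriv_ofReal {φ : E3 → ℝ} (hφ : ContDiff ℝ ∞ φ) (α : Fin 3 → ℕ) :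
    multiDeriv α (fun x => (φ x : ℂ)) = fun x => ((multiDeriv α φ x : ℝ) : ℂ) := by
  have h2 := contDiff_iterate_partialDeriv hφ 2 (α 2)
  have h1 := contDiff_iterate_partialDeriv h2 1 (α 1)
  rw [multiDeriv, iterate_partialDeriv_ofReal hφ, iterate_partialDeriv_ofReal h2,
    iterate_partialDeriv_ofReal h1]
  rfl

theorem iterate_partialDeriv_schwartz (φ : 𝓢(E3, ℂ)) (i : Fin 3) (n : ℕ) :
    (partialDeriv i)^[n] (φ : E3 → ℂ) =
      ((∂_{EuclideanSpace.single i (1 : ℝ)})^[n] φ : 𝓢(E3, ℂ)) := by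
  induction n with
  | zero => rfl
  | succ n ih =>
    rw [Function.iterate_succ_apply', Function.iterate_succ_apply', ih]
    rfl

theorem fourierInv_iterate_lineDeriv (φ : 𝓢(E3, ℂ)) (i : Fin 3) (n : ℕ) (ξ : E3) :
    (𝓕⁻ ((∂_{EuclideanSpace.single i (1 : ℝ)})^[n] φ : 𝓢(E3, ℂ)) : 𝓢(E3, ℂ)) ξ =
      (-(2 * Real.pi * Complex.I * ξ i)) ^ n * (𝓕⁻ φ : 𝓢(E3, ℂ)) ξ := by
  induction n with
  | zero => simp
  | succ n ih =>
    rw [Function.iterate_succ_apply', SchwartzMap.fourierInv_lineDerivOp_eq]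
    have : (inner ℝ · (EuclideanSpace.single i (1 : ℝ)) : E3 → ℝ).HasTemperateGrowth := by fun_prop
    rw [smul_apply, SchwartzMap.smulLeftCLM_apply_apply this, ih]
    simp [EuclideanSpace.inner_single_right]
    ring

/-- The Fourier symbol `(2πiξ)^α` of the differential operator `∂^α`. -/
def derivSymbol (α : Fin 3 → ℕ) (ξ : E3) : ℂ :=
  ∏ i, (2 * Real.pi * Complex.I * ξ i) ^ α i

theorem continuous_derivSymbol (α : Fin 3 → ℕ) : Continuous (derivSymbol α) := by
  unfold derivSymbol
  fun_prop

theorem norm_derivSymbol_le (α : Fin 3 → ℕ) (ξ : E3) :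
    ‖derivSymbol α ξ‖ ≤ (2 * Real.pi * ‖ξ‖) ^ (∑ i, α i) := by
  rw [derivSymbol, norm_prod, ← Finset.prod_pow_eq_pow_sum]
  refine Finset.prod_le_prod (fun _ _ => norm_nonneg _) fun i _ => ?_
  rw [norm_pow]
  refine pow_le_pow_left₀ (norm_nonneg _) ?_ _
  have h' := PiLp.norm_apply_le ξ i
  simp only [norm_mul, Complex.norm_I, Complex.norm_real, Complex.norm_ofNat, mul_one,
    Real.norm_eq_abs, abs_of_pos Real.pi_pos] at h' ⊢
  gcongr

/-- `∂^α φ` as a Schwartz function, together with its inverse Fourier transform. -/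
theorem exists_schwartz_multiDeriv (φ : 𝓢(E3, ℂ)) (α : Fin 3 → ℕ) :
    ∃ ψ : 𝓢(E3, ℂ), (ψ : E3 → ℂ) = multiDeriv α φ ∧
      ∀ ξ, (𝓕⁻ ψ : 𝓢(E3, ℂ)) ξ =
        (-1) ^ (∑ i, α i) * (derivSymbol α ξ * (𝓕⁻ φ : 𝓢(E3, ℂ)) ξ) := by
  refine ⟨(∂_{EuclideanSpace.single (0 : Fin 3) (1 : ℝ)})^[α 0] ((∂_{EuclideanSpace.single (1 : Fin 3) (1 : ℝ)})^[α 1]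
    ((∂_{EuclideanSpace.single (2 : Fin 3) (1 : ℝ)})^[α 2] φ)), ?_, fun ξ => ?_⟩
  · rw [multiDeriv, iterate_partialDeriv_schwartz, iterate_partialDeriv_schwartz,
      iterate_partialDeriv_schwartz]
  · rw [fourierInv_iterate_lineDeriv, fourierInv_iterate_lineDeriv, fourierInv_iterate_lineDeriv,
      derivSymbol, Fin.sum_univ_three, Fin.prod_univ_three, neg_pow, neg_pow (_ * ξ 1 : ℂ),
      neg_pow (_ * ξ 2 : ℂ)]
    ring

/-- Self-adjointness of the Fourier transform, for an integrable function and a Schwartz function. -/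
theorem integral_fourier_mul_schwartz {f : E3 → ℂ} (hf : Integrable f) (φ : 𝓢(E3, ℂ)) :
    ∫ ξ, 𝓕 f ξ * φ ξ = ∫ x, f x * (𝓕 φ : 𝓢(E3, ℂ)) x := by
  simpa [SchwartzMap.fourier_coe] using! VectorFourier.integral_fourierIntegral_smul_eq_flip
    (L := innerₗ E3) Real.continuous_fourierChar continuous_inner hf φ.integrable

theorem continuous_fourier {f : E3 → ℂ} (hf : Integrable f) : Continuous (𝓕 f) :=
  VectorFourier.fourierIntegral_continuous Real.continuous_fourierChar
    (by exact continuous_inner) hf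

/-- On `L¹ ∩ L²` the Fourier transform defined by density is the Fourier integral. -/
theorem fourier_toLp_ae_eq {f : E3 → ℂ} (hf : Integrable f) (hf2 : MemLp f 2) :
    (𝓕 (hf2.toLp f) : Lp ℂ 2 (volume : Measure E3)) =ᵐ[volume] 𝓕 f := by
  set g : Lp ℂ 2 (volume : Measure E3) := 𝓕 (hf2.toLp f)
  refine ae_eq_of_integral_contDiff_smul_eq ((Lp.memLp g).locallyIntegrable (by norm_num))
    (continuous_fourier hf).locallyIntegrable fun φ h1 h2 => ?_
  have hφ₁ : HasCompactSupport (Complex.ofRealCLM ∘ φ) := h2.comp_left rfl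
  have hφ₂ : ContDiff ℝ ∞ (Complex.ofRealCLM ∘ φ) := by fun_prop
  set Φ : 𝓢(E3, ℂ) := hφ₁.toSchwartzMap hφ₂
  have hΦ : ∀ x, Φ x = (φ x : ℂ) := fun x => rfl
  have e1 := congrArg (fun T => T Φ) (Lp.fourier_toTemperedDistribution_eq (hf2.toLp f))
  simp only [TemperedDistribution.fourier_apply, Lp.toTemperedDistribution_apply] at e1
  have e2 := integral_fourier_mul_schwartz hf Φ
  calc ∫ x, φ x • g x = ∫ x, Φ x • g x := by simp [hΦ]
    _ = ∫ x, (𝓕 Φ : 𝓢(E3, ℂ)) x • (hf2.toLp f) x := e1.symm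
    _ = ∫ x, f x * (𝓕 Φ : 𝓢(E3, ℂ)) x := by
      refine integral_congr_ae ?_
      filter_upwards [hf2.coeFn_toLp] with x hx
      rw [hx, smul_eq_mul, mul_comm]
    _ = ∫ x, φ x • 𝓕 f x := by
      rw [← e2]
      simp [hΦ, mul_comm]

theorem eLpNorm_fourier {f : E3 → ℂ} (hf : Integrable f) (hf2 : MemLp f 2) :
    eLpNorm (𝓕 f) 2 volume = eLpNorm f 2 volume := by
  have h := Lp.norm_fourier_eq (hf2.toLp f)
  rw [Lp.norm_def, Lp.norm_def, ENNReal.toReal_eq_toReal_iff' (Lp.memLp _).eLpNorm_ne_top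
    (Lp.memLp _).eLpNorm_ne_top, eLpNorm_congr_ae (fourier_toLp_ae_eq hf hf2),
    eLpNorm_congr_ae hf2.coeFn_toLp] at h
  exact h

/-- If the Fourier transform of an integrable kernel `K` decays so that `(2π|ξ|)^|α| |K̂(ξ)| ≤ M`,
then `K ⋆ f` has a weak derivative `∂^α (K ⋆ f)` whose `L²` norm is at most `M ‖f‖`. -/
theorem exists_weakDeriv_convolution {K f : E3 → ℂ} (hK : Integrable K) (hf : Integrable f)
    (hf2 : MemLp f 2) (α : Fin 3 → ℕ) {M : ℝ}
    (hM : ∀ᵐ ξ, (2 * Real.pi * ‖ξ‖) ^ (∑ i, α i) * ‖𝓕 K ξ‖ ≤ M) :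
    ∃ v : E3 → ℂ, MemLp v 2 ∧ eLpNorm v 2 volume ≤ ENNReal.ofReal M * eLpNorm f 2 volume ∧
      ∀ φ : E3 → ℝ, ContDiff ℝ ∞ φ → HasCompactSupport φ →
        ∫ x, ((multiDeriv α φ x : ℝ) : ℂ) * (K ⋆[ContinuousLinearMap.mul ℂ ℂ] f) x =
          (-1) ^ (∑ i, α i) * ∫ x, (φ x : ℂ) * v x := by
  set u : E3 → ℂ := K ⋆[ContinuousLinearMap.mul ℂ ℂ] f
  have hu : Integrable u := hK.integrable_convolution _ hf
  have hFu : ∀ ξ, 𝓕 u ξ = 𝓕 K ξ * 𝓕 f ξ := Real.fourier_mul_convolution_eq hK hf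
  set w : E3 → ℂ := fun ξ => derivSymbol α ξ * 𝓕 u ξ
  have hw_le : ∀ᵐ ξ, ‖w ξ‖ ≤ M * ‖𝓕 f ξ‖ := by
    filter_upwards [hM] with ξ hξ
    simp only [w, hFu, norm_mul, ← mul_assoc]
    gcongr
    exact (mul_le_mul_of_nonneg_right (norm_derivSymbol_le α ξ) (norm_nonneg _)).trans hξ
  have hFf : MemLp (𝓕 f) 2 := by
    refine ⟨(continuous_fourier hf).aestronglyMeasurable, ?_⟩
    rw [eLpNorm_fourier hf hf2]
    exact hf2.2
  have hw : MemLp w 2 :=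
    hFf.of_le_mul ((continuous_derivSymbol α).mul
      (continuous_fourier hu)).aestronglyMeasurable hw_le
  set v : Lp ℂ 2 (volume : Measure E3) := 𝓕⁻ (hw.toLp w)
  refine ⟨v, Lp.memLp v, ?_, fun φ h1 h2 => ?_⟩
  · have hn : ‖𝓕 v‖ = ‖v‖ := Lp.norm_fourier_eq v
    rw [show 𝓕 v = hw.toLp w from FourierTransform.fourier_fourierInv_eq _, Lp.norm_def, Lp.norm_def,
      ENNReal.toReal_eq_toReal_iff' (Lp.memLp _).eLpNorm_ne_top (Lp.memLp _).eLpNorm_ne_top,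
      eLpNorm_congr_ae hw.coeFn_toLp] at hn
    rw [← hn, ← eLpNorm_fourier hf hf2]
    exact eLpNorm_le_mul_eLpNorm_of_ae_le_mul hw_le 2
  · have hφ₁ : HasCompactSupport (Complex.ofRealCLM ∘ φ) := h2.comp_left rfl
    have hφ₂ : ContDiff ℝ ∞ (Complex.ofRealCLM ∘ φ) := by fun_prop
    set Φ : 𝓢(E3, ℂ) := hφ₁.toSchwartzMap hφ₂
    have hΦ : (Φ : E3 → ℂ) = fun x => (φ x : ℂ) := rfl
    obtain ⟨Ψ, hΨ, hΨF⟩ := exists_schwartz_multiDeriv Φ α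
    rw [hΦ, multiDeriv_ofReal h1] at hΨ
    have e1 := congrArg (fun T => T Φ) (Lp.fourierInv_toTemperedDistribution_eq (hw.toLp w))
    simp only [TemperedDistribution.fourierInv_apply, Lp.toTemperedDistribution_apply] at e1
    calc ∫ x, ((multiDeriv α φ x : ℝ) : ℂ) * u x = ∫ x, u x * Ψ x := by
          simp [hΨ, mul_comm]
      _ = ∫ x, u x * (𝓕 (𝓕⁻ Ψ : 𝓢(E3, ℂ)) : 𝓢(E3, ℂ)) x := by
          rw [FourierTransform.fourier_fourierInv_eq]
      _ = ∫ ξ, 𝓕 u ξ * (𝓕⁻ Ψ : 𝓢(E3, ℂ)) ξ := (integral_fourier_mul_schwartz hu _).symm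
      _ = ∫ ξ, (-1) ^ (∑ i, α i) * ((𝓕⁻ Φ : 𝓢(E3, ℂ)) ξ * w ξ) := by
          refine integral_congr_ae (Filter.Eventually.of_forall fun ξ => ?_)
          simp only [hΨF, w]
          ring
      _ = (-1) ^ (∑ i, α i) * ∫ ξ, (𝓕⁻ Φ : 𝓢(E3, ℂ)) ξ * (hw.toLp w) ξ := by
          rw [integral_const_mul]
          congr 1
          refine integral_congr_ae ?_
          filter_upwards [hw.coeFn_toLp] with x hx
          rw [hx]
      _ = (-1) ^ (∑ i, α i) * ∫ x, (φ x : ℂ) * v x := by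
          congr 1

/-! ### The Fourier transform of radial functions -/

theorem integrableOn_Ioi_of_eq_zero {g : ℝ → ℂ} (hg : Continuous g) {A : ℝ}
    (h0 : ∀ r, A ≤ r → g r = 0) : IntegrableOn g (Set.Ioi 0) := by
  refine (hg.integrableOn_Icc (a := 0) (b := A)).of_forall_sdiff_eq_zero measurableSet_Ioi
    fun x hx => h0 x ?_
  by_contra hlt
  exact hx.2 ⟨hx.1.out.le, (not_le.mp hlt).le⟩

theorem integrable_radial_div {h : ℝ → ℂ} (hc : Continuous h) {A : ℝ}
    (h0 : ∀ r, A ≤ r → h r = 0) : Integrable fun x : E3 => h ‖x‖ / ‖x‖ := by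
  rw [integrable_fun_norm_addHaar volume (f := fun r : ℝ => h r / r)]
  have h1 : IntegrableOn (fun r : ℝ => (r : ℂ) * h r) (Set.Ioi 0) :=
    integrableOn_Ioi_of_eq_zero (by fun_prop) fun r hr => by rw [h0 r hr, mul_zero]
  refine h1.congr_fun (fun r hr => ?_) measurableSet_Ioi
  have hr' : (r : ℂ) ≠ 0 := by exact_mod_cast hr.out.ne'
  simp only [finrank_euclideanSpace, Fintype.card_fin]
  rw [Complex.real_smul]
  push_cast
  field_simp

/-- Integration over the plane of `h(ρ)/ρ` with `ρ = √(z² + |w|²)`: substituting `ρ` for `|w|`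
cancels the denominator. -/
theorem integral_plane_radial {h : ℝ → ℂ} (hc : Continuous h) {A : ℝ}
    (h0 : ∀ r, A ≤ r → h r = 0) {z : ℝ} (hz : z ≠ 0) :
    ∫ w : EuclideanSpace ℝ (Fin 2), h √(z ^ 2 + ‖w‖ ^ 2) / √(z ^ 2 + ‖w‖ ^ 2) =
      2 * Real.pi * ∫ r in |z|..A, h r := by
  have hpos : ∀ y : ℝ, 0 < z ^ 2 + y ^ 2 := fun y => by positivity
  have hsq : ∀ y : ℝ, 0 < √(z ^ 2 + y ^ 2) := fun y => Real.sqrt_pos.mpr (hpos y)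
  have hle : ∀ y : ℝ, y ≤ √(z ^ 2 + y ^ 2) := fun y =>
    Real.le_sqrt_of_sq_le (by nlinarith [sq_nonneg z])
  have hcont : Continuous fun y : ℝ => (y : ℂ) * (h √(z ^ 2 + y ^ 2) / √(z ^ 2 + y ^ 2)) := by
    refine Complex.continuous_ofReal.mul (Continuous.div (by fun_prop) (by fun_prop) fun y => ?_)
    exact_mod_cast (hsq y).ne'
  have hder : ∀ y : ℝ, HasDerivAt (fun y : ℝ => ∫ r in |z|..√(z ^ 2 + y ^ 2), h r)
      ((y : ℂ) * (h √(z ^ 2 + y ^ 2) / √(z ^ 2 + y ^ 2))) y := fun y => by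
    have d1 : HasDerivAt (fun y : ℝ => z ^ 2 + y ^ 2) (2 * y) y := by
      simpa using (hasDerivAt_pow 2 y).const_add (z ^ 2)
    have d2 := d1.sqrt (hpos y).ne'
    have d3 : HasDerivAt (fun s : ℝ => ∫ r in |z|..s, h r) (h √(z ^ 2 + y ^ 2))
        (√(z ^ 2 + y ^ 2)) :=
      intervalIntegral.integral_hasDerivAt_right (hc.intervalIntegrable _ _)
        (hc.stronglyMeasurableAtFilter _ _) hc.continuousAt
    refine (d3.scomp y d2).congr_deriv ?_
    have hne : ((√(z ^ 2 + y ^ 2) : ℝ) : ℂ) ≠ 0 := by exact_mod_cast (hsq y).ne'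
    rw [Complex.real_smul]
    push_cast
    field_simp
  have hlim : Filter.Tendsto (fun y : ℝ => ∫ r in |z|..√(z ^ 2 + y ^ 2), h r) Filter.atTop
      (nhds (∫ r in |z|..A, h r)) := by
    refine tendsto_const_nhds.congr' ?_
    filter_upwards [Filter.eventually_ge_atTop A] with y hy
    have hA : A ≤ √(z ^ 2 + y ^ 2) := hy.trans (hle y)
    rw [← intervalIntegral.integral_add_adjacent_intervals (hc.intervalIntegrable |z| A)
      (hc.intervalIntegrable A √(z ^ 2 + y ^ 2)), left_eq_add]
    refine (intervalIntegral.integral_congr (g := fun _ => 0) fun r hr => ?_).trans (by simp)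
    rw [Set.uIcc_of_le hA] at hr
    exact h0 r hr.1
  have hIoi := integral_Ioi_of_hasDerivAt_of_tendsto' (a := 0) (fun y _ => hder y)
    (integrableOn_Ioi_of_eq_zero hcont (A := A) fun r hr => by
      rw [h0 _ (hr.trans (hle r)), zero_div, mul_zero]) hlim
  rw [integral_fun_norm_addHaar volume (f := fun y : ℝ => h √(z ^ 2 + y ^ 2) / √(z ^ 2 + y ^ 2))]
  have hvol : (volume : Measure (EuclideanSpace ℝ (Fin 2))).real (Metric.ball 0 1) = Real.pi := by
    rw [Measure.real, InnerProductSpace.volume_ball_of_dim_even (k := 1) (by simp)]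
    simp [Real.pi_pos.le]
  rw [hvol]
  simp only [finrank_euclideanSpace, Fintype.card_fin, Nat.add_one_sub_one, pow_one,
    Complex.real_smul]
  have h00 : |z| = √(z ^ 2 + 0 ^ 2) := by simp [Real.sqrt_sq_eq_abs]
  rw [hIoi, ← h00, intervalIntegral.integral_same]
  simp
  ring

/-- Cartesian coordinates split off the first axis of space. -/
theorem integral_split_first_coord {g : ℝ → ℝ → ℂ}
    (hg : Integrable fun y : E3 => g (y 0) ‖y‖) :
    ∫ y : E3, g (y 0) ‖y‖ =
      ∫ z : ℝ, ∫ w : EuclideanSpace ℝ (Fin 2), g z √(z ^ 2 + ‖w‖ ^ 2) := by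
  set e : E3 ≃ᵐ ℝ × EuclideanSpace ℝ (Fin 2) :=
    ((MeasurableEquiv.toLp 2 (Fin 3 → ℝ)).symm.trans
      (MeasurableEquiv.piFinSuccAbove (fun _ => ℝ) 0)).trans
      ((MeasurableEquiv.refl ℝ).prodCongr (MeasurableEquiv.toLp 2 (Fin 2 → ℝ)))
  have he : MeasurePreserving e := by
    refine ((EuclideanSpace.volume_preserving_symm_measurableEquiv_toLp (Fin 3)).trans
      (volume_preserving_piFinSuccAbove (fun _ => ℝ) 0)).trans ?_
    exact (MeasurePreserving.id volume).prod (PiLp.volume_preserving_toLp (Fin 2))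
  have hval : ∀ y : E3, g (y 0) ‖y‖ =
      (fun p : ℝ × EuclideanSpace ℝ (Fin 2) => g p.1 √(p.1 ^ 2 + ‖p.2‖ ^ 2)) (e y) := fun y => by
    have h1 : (e y).1 = y 0 := rfl
    have h2 : ∀ i : Fin 2, (e y).2 i = y i.succ := fun i => rfl
    simp only [h1]
    rw [EuclideanSpace.norm_eq y, EuclideanSpace.norm_sq_eq]
    simp [h2, Fin.sum_univ_three]
    congr 2
    ring
  have hg' := hg
  rw [funext hval] at hg'
  rw [funext hval]
  refine (he.integral_comp e.measurableEmbedding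
    (fun p => g p.1 √(p.1 ^ 2 + ‖p.2‖ ^ 2))).trans ?_
  rw [Measure.volume_eq_prod, integral_prod]
  exact (he.integrable_comp_emb e.measurableEmbedding).mp hg'

theorem exists_orthonormalBasis_inner_eq (ξ : E3) :
    ∃ b : OrthonormalBasis (Fin 3) ℝ E3, ∀ x, inner ℝ x ξ = ‖ξ‖ * b.repr x 0 := by
  by_cases hξ : ξ = 0
  · exact ⟨EuclideanSpace.basisFun (Fin 3) ℝ, fun x => by simp [hξ]⟩
  have hn : ‖ξ‖ ≠ 0 := norm_ne_zero_iff.mpr hξ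
  obtain ⟨b, hb⟩ := Orthonormal.exists_orthonormalBasis_extension_of_card_eq (𝕜 := ℝ) (E := E3)
    (ι := Fin 3) (by simp) (v := fun _ => ‖ξ‖⁻¹ • ξ) (s := {0}) (by
      rw [orthonormal_iff_ite]
      rintro ⟨i, rfl⟩ ⟨j, rfl⟩
      simp [norm_smul, hn])
  refine ⟨b, fun x => ?_⟩
  rw [b.repr_apply_apply, hb 0 rfl, inner_smul_left, real_inner_comm]
  simp [hn]

/-- Integrating over the planes orthogonal to `ξ` reduces the Fourier transform of a radial function
to a one-dimensional one. -/
theorem fourier_radial_slices {h : ℝ → ℂ} (hc : Continuous h) {A : ℝ}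
    (h0 : ∀ r, A ≤ r → h r = 0) (ξ : E3) :
    𝓕 (fun x : E3 => h ‖x‖ / ‖x‖) ξ =
      ∫ z : ℝ, Complex.exp (-(2 * Real.pi * ‖ξ‖ * z) * Complex.I) *
        (2 * Real.pi * ∫ r in |z|..A, h r) := by
  obtain ⟨b, hb⟩ := exists_orthonormalBasis_inner_eq ξ
  have hF := integrable_radial_div hc h0
  set g : ℝ → ℝ → ℂ := fun z r => Complex.exp (-(2 * Real.pi * ‖ξ‖ * z) * Complex.I) * (h r / r)
  have hval : ∀ x : E3, Complex.exp ((-2 * Real.pi * inner ℝ x ξ : ℝ) * Complex.I) •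
      (h ‖x‖ / ‖x‖) = (fun y : E3 => g (y 0) ‖y‖) (b.repr x) := fun x => by
    simp only [g, hb, b.repr.norm_map, smul_eq_mul]
    push_cast
    ring_nf
  rw [Real.fourier_eq']
  rw [funext hval]
  refine (b.measurePreserving_repr.integral_comp
    b.repr.toHomeomorph.measurableEmbedding (fun y => g (y 0) ‖y‖)).trans ?_
  rw [integral_split_first_coord]
  · refine integral_congr_ae ?_
    filter_upwards [Measure.ae_ne volume (0 : ℝ)] with z hz
    simp only [g]
    rw [integral_const_mul, integral_plane_radial hc h0 hz]
  · refine hF.bdd_mul (c := 1) (by fun_prop) (Filter.Eventually.of_forall fun y => ?_)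
    rw [show (-(2 * Real.pi * ‖ξ‖ * (y 0 : ℝ)) * Complex.I : ℂ) =
      ((-(2 * Real.pi * ‖ξ‖ * y 0) : ℝ) : ℂ) * Complex.I by push_cast; ring,
      Complex.norm_exp_ofReal_mul_I]

/-- The Fourier transform of the radial function `h(|x|)/|x|` in dimension three is the sine
transform of `h`. -/
theorem fourier_radial {h : ℝ → ℂ} (hc : Continuous h) {A : ℝ} (hA : 0 ≤ A)
    (h0 : ∀ r, A ≤ r → h r = 0) (ξ : E3) :
    ((2 * Real.pi * ‖ξ‖ : ℝ) : ℂ) * 𝓕 (fun x : E3 => h ‖x‖ / ‖x‖) ξ =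
      4 * Real.pi * ∫ r in 0..A, (Real.sin (2 * Real.pi * ‖ξ‖ * r) : ℂ) * h r := by
  set σ : ℝ := 2 * Real.pi * ‖ξ‖
  set Q : ℝ → ℂ := fun t => ∫ r in t..A, h r
  have hQ : ∀ t, HasDerivAt Q (-h t) t := fun t =>
    intervalIntegral.integral_hasDerivAt_left (hc.intervalIntegrable _ _)
        (hc.stronglyMeasurableAtFilter _ _) hc.continuousAt
  have hQc : Continuous Q := continuous_iff_continuousAt.mpr fun t => (hQ t).continuousAt
  have hQ0 : ∀ t, A ≤ t → Q t = 0 := fun t ht => by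
    refine (intervalIntegral.integral_congr (g := fun _ => 0) fun r hr => ?_).trans (by simp)
    rw [Set.uIcc_of_ge ht] at hr
    exact h0 r hr.1
  set E : ℝ → ℂ := fun z => Complex.exp (-(σ * z) * Complex.I) * (2 * Real.pi * Q |z|)
  have hEc : Continuous E := by fun_prop
  have hslice : 𝓕 (fun x : E3 => h ‖x‖ / ‖x‖) ξ = ∫ z, E z := by
    rw [fourier_radial_slices hc h0]
    simp only [E, Q, σ]
    push_cast
    rfl
  have hE : ∫ z, E z = ∫ z in -A..A, E z := by
    refine (intervalIntegral.integral_eq_integral_of_support_subset fun z hz => ?_).symm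
    have hlt : |z| < A := by
      by_contra hle
      exact hz (by simp [E, hQ0 _ (not_lt.mp hle)])
    exact ⟨(abs_lt.mp hlt).1, (abs_lt.mp hlt).2.le⟩
  -- The slice integrals are even in `z`, so the exponential folds to a cosine on `[0, A]`.
  have hfold : ∫ z in -A..A, E z = 4 * Real.pi * ∫ z in 0..A, Q z * Real.cos (σ * z) := by
    rw [← intervalIntegral.integral_add_adjacent_intervals (b := 0) (hEc.intervalIntegrable _ _)
      (hEc.intervalIntegrable _ _)]
    have hneg : ∫ z in -A..0, E z = ∫ z in 0..A, E (-z) := by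
      simp [intervalIntegral.integral_comp_neg]
    rw [hneg, ← intervalIntegral.integral_add (Continuous.intervalIntegrable (by fun_prop) _ _)
      (hEc.intervalIntegrable _ _), ← intervalIntegral.integral_const_mul]
    refine intervalIntegral.integral_congr fun z hz => ?_
    rw [Set.uIcc_of_le hA] at hz
    simp only [E, abs_neg, abs_of_nonneg hz.1, Complex.ofReal_cos, Complex.cos]
    push_cast
    ring_nf
  have hibp := intervalIntegral.integral_mul_deriv_eq_deriv_mul (a := 0) (b := A)
    (u := Q) (u' := fun t => -h t) (v := fun t : ℝ => ((Real.sin (σ * t) : ℝ) : ℂ))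
    (v' := fun t : ℝ => ((Real.cos (σ * t) * σ : ℝ) : ℂ)) (fun t _ => hQ t)
    (fun t _ => by
      have d : HasDerivAt (fun t : ℝ => σ * t) σ t := by
        simpa using (hasDerivAt_id t).const_mul σ
      exact d.sin.ofReal_comp)
    (by exact (hc.neg).intervalIntegrable _ _)
    (by exact Continuous.intervalIntegrable (by fun_prop) _ _)
  rw [hslice, hE, hfold, mul_left_comm, ← intervalIntegral.integral_const_mul]
  congr 1
  have hl : ∫ t in 0..A, (σ : ℂ) * (Q t * Real.cos (σ * t)) =
      ∫ t in 0..A, Q t * ((Real.cos (σ * t) * σ : ℝ) : ℂ) := by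
    congr 1
    funext t
    push_cast
    ring
  rw [hl, hibp, hQ0 A le_rfl]
  simp only [mul_zero, Real.sin_zero, Complex.ofReal_zero, zero_mul, sub_zero, zero_sub]
  rw [← intervalIntegral.integral_neg]
  congr 1
  funext t
  ring

/-! ### Sine transforms of smoothly truncated waves -/

theorem hasDerivAt_sin_ofReal (σ t : ℝ) :
    HasDerivAt (fun t : ℝ => ((Real.sin (σ * t) : ℝ) : ℂ)) (Real.cos (σ * t) * σ) t := by
  have d : HasDerivAt (fun t : ℝ => σ * t) σ t := by
    simpa using (hasDerivAt_id t).const_mul σ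
  simpa using d.sin.ofReal_comp

theorem hasDerivAt_cos_ofReal (σ t : ℝ) :
    HasDerivAt (fun t : ℝ => ((Real.cos (σ * t) : ℝ) : ℂ)) (-Real.sin (σ * t) * σ) t := by
  have d : HasDerivAt (fun t : ℝ => σ * t) σ t := by
    simpa using (hasDerivAt_id t).const_mul σ
  simpa using d.cos.ofReal_comp

theorem mul_sine_integral {g : ℝ → ℂ} (hg : ContDiff ℝ 1 g) {A : ℝ} (hA : g A = 0) (σ : ℝ) :
    (σ : ℂ) * ∫ r in 0..A, (Real.sin (σ * r) : ℂ) * g r =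
      g 0 + ∫ r in 0..A, (Real.cos (σ * r) : ℂ) * deriv g r := by
  have hdc : Continuous (deriv g) := hg.continuous_deriv le_rfl
  have hgc := hg.continuous
  have h := intervalIntegral.integral_mul_deriv_eq_deriv_mul (a := 0) (b := A)
    (u := g) (u' := deriv g) (v := fun t : ℝ => ((Real.cos (σ * t) : ℝ) : ℂ))
    (v' := fun t : ℝ => (-Real.sin (σ * t) * σ : ℂ))
    (fun t _ => (hg.differentiable (by simp) t).hasDerivAt) (fun t _ => hasDerivAt_cos_ofReal σ t)
    (hdc.intervalIntegrable _ _) (by exact Continuous.intervalIntegrable (by fun_prop) _ _)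
  rw [hA] at h
  have e1 : (σ : ℂ) * ∫ r in 0..A, (Real.sin (σ * r) : ℂ) * g r =
      -∫ t in 0..A, g t * (-Real.sin (σ * t) * σ : ℂ) := by
    rw [← intervalIntegral.integral_const_mul, ← intervalIntegral.integral_neg]
    congr 1
    funext t
    ring
  rw [e1, h]
  simp [mul_comm, add_comm]

theorem mul_cosine_integral {g : ℝ → ℂ} (hg : ContDiff ℝ 1 g) {A : ℝ} (hA : g A = 0) (σ : ℝ) :
    (σ : ℂ) * ∫ r in 0..A, (Real.cos (σ * r) : ℂ) * g r =
      -∫ r in 0..A, (Real.sin (σ * r) : ℂ) * deriv g r := by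
  have hdc : Continuous (deriv g) := hg.continuous_deriv le_rfl
  have hgc := hg.continuous
  have h := intervalIntegral.integral_mul_deriv_eq_deriv_mul (a := 0) (b := A)
    (u := g) (u' := deriv g) (v := fun t : ℝ => ((Real.sin (σ * t) : ℝ) : ℂ))
    (v' := fun t : ℝ => (Real.cos (σ * t) * σ : ℂ))
    (fun t _ => (hg.differentiable (by simp) t).hasDerivAt) (fun t _ => hasDerivAt_sin_ofReal σ t)
    (hdc.intervalIntegrable _ _) (by exact Continuous.intervalIntegrable (by fun_prop) _ _)
  rw [hA] at h
  have e1 : (σ : ℂ) * ∫ r in 0..A, (Real.cos (σ * r) : ℂ) * g r =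
      ∫ t in 0..A, g t * (Real.cos (σ * t) * σ : ℂ) := by
    rw [← intervalIntegral.integral_const_mul]
    congr 1
    funext t
    ring
  rw [e1, h]
  simp [mul_comm]

theorem norm_sine_integral_le {g : ℝ → ℂ} {A M : ℝ} (hA : 0 ≤ A) (hM : ∀ r, ‖g r‖ ≤ M) (σ : ℝ) :
    ‖∫ r in 0..A, (Real.sin (σ * r) : ℂ) * g r‖ ≤ A * M := by
  have h := intervalIntegral.norm_integral_le_of_norm_le_const (a := 0) (b := A) (C := M)
    (f := fun r => (Real.sin (σ * r) : ℂ) * g r) fun r _ => by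
      rw [norm_mul, Complex.norm_real, Real.norm_eq_abs]
      exact (mul_le_of_le_one_left (norm_nonneg _) (Real.abs_sin_le_one _)).trans (hM r)
  rwa [sub_zero, abs_of_nonneg hA, mul_comm] at h

theorem norm_cosine_integral_le {g : ℝ → ℂ} {A M : ℝ} (hA : 0 ≤ A) (hM : ∀ r, ‖g r‖ ≤ M)
    (σ : ℝ) : ‖∫ r in 0..A, (Real.cos (σ * r) : ℂ) * g r‖ ≤ A * M := by
  have h := intervalIntegral.norm_integral_le_of_norm_le_const (a := 0) (b := A) (C := M)
    (f := fun r => (Real.cos (σ * r) : ℂ) * g r) fun r _ => by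
      rw [norm_mul, Complex.norm_real, Real.norm_eq_abs]
      exact (mul_le_of_le_one_left (norm_nonneg _) (Real.abs_cos_le_one _)).trans (hM r)
  rwa [sub_zero, abs_of_nonneg hA, mul_comm] at h

/-- Repeated integration by parts. As `h` vanishes at `0`, the first step leaves no boundary term;
the only one, `h''(0)`, appears for `m = 2`. With `M` of the size of the wave number, each power of
`σ` costs a factor `M`. -/
theorem pow_mul_norm_sine_integral_le {h : ℝ → ℂ} (hh : ContDiff ℝ 3 h) {A : ℝ} (hA : 0 ≤ A)
    (hev : ∀ᶠ r in nhds A, h r = 0) (h0 : h 0 = 0) {B M : ℝ} (hM : 1 ≤ M)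
    (hB : ∀ n ≤ 3, ∀ r, ‖iteratedDeriv n h r‖ ≤ B * M ^ n) {σ : ℝ} (hσ : 0 ≤ σ) {m : ℕ}
    (hm : m ≤ 2) :
    σ ^ (m + 1) * ‖∫ r in 0..A, (Real.sin (σ * r) : ℂ) * h r‖ ≤ (1 + A) * B * M ^ (m + 1) := by
  have hev' : h =ᶠ[nhds A] fun _ => 0 := hev
  have hvan : ∀ n, iteratedDeriv n h A = 0 := fun n => by
    rw [hev'.iteratedDeriv_eq]
    simp
  have hB0 : 0 ≤ B := by
    have := (norm_nonneg _).trans (hB 0 (by norm_num) 0)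
    simpa using this
  have hsmooth : ∀ n ≤ 2, ContDiff ℝ 1 (iteratedDeriv n h) := fun n hn => by
    rw [iteratedDeriv_eq_iterate]
    refine ContDiff.iterate_deriv' 1 n (hh.of_le ?_)
    exact_mod_cast (by omega : 1 + n ≤ 3)
  have e1 := mul_sine_integral (hsmooth 0 (by norm_num)) (hvan 0) σ
  have e2 := mul_cosine_integral (hsmooth 1 (by norm_num)) (hvan 1) σ
  have e3 := mul_sine_integral (hsmooth 2 (by norm_num)) (hvan 2) σ
  simp only [← iteratedDeriv_succ, zero_add, Nat.reduceAdd] at e1 e2 e3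
  simp only [iteratedDeriv_zero, h0, zero_add] at e1
  have hnorm : ‖(σ : ℂ)‖ = σ := by simp [abs_of_nonneg hσ]
  have key : σ ^ (m + 1) * ‖∫ r in 0..A, (Real.sin (σ * r) : ℂ) * h r‖ =
      ‖(σ : ℂ) ^ m * ((σ : ℂ) * ∫ r in 0..A, (Real.sin (σ * r) : ℂ) * h r)‖ := by
    rw [norm_mul, norm_mul, norm_pow, hnorm]
    ring
  rw [key, e1]
  interval_cases m
  · have := norm_cosine_integral_le hA (hB 1 (by norm_num)) σ
    simp only [pow_zero, one_mul, zero_add, pow_one] at this ⊢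
    nlinarith [mul_nonneg hB0 (zero_le_one.trans hM)]
  · rw [pow_one, e2, norm_neg]
    refine (norm_sine_integral_le hA (hB 2 (by norm_num)) σ).trans ?_
    have : 0 ≤ B * M ^ 2 := mul_nonneg hB0 (pow_nonneg (zero_le_one.trans hM) 2)
    simp only [Nat.reduceAdd]
    linarith
  · rw [pow_two, mul_assoc, e2, mul_neg, e3, norm_neg]
    have h2 := hB 2 (by norm_num) 0
    have h3 := norm_cosine_integral_le hA (hB 3 (by norm_num)) σ
    have hM23 : B * M ^ 2 ≤ B * M ^ 3 :=
      mul_le_mul_of_nonneg_left (pow_le_pow_right₀ hM (by norm_num)) hB0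
    refine (norm_add_le_of_le h2 h3).trans ?_
    simp only [Nat.reduceAdd]
    linarith

/-- The truncated wave `η(r) e^{iκr}`. -/
def truncWave (η : ContDiffBump (0 : ℝ)) (κ r : ℝ) : ℂ :=
  η r * Complex.exp (Complex.I * κ * r)

theorem contDiff_truncWave (η : ContDiffBump (0 : ℝ)) (κ : ℝ) : ContDiff ℝ ∞ (truncWave η κ) := by
  unfold truncWave
  have h1 : ContDiff ℝ ∞ (fun r : ℝ => (η r : ℂ)) := Complex.ofRealCLM.contDiff.comp η.contDiff
  have h2 : ContDiff ℝ ∞ (fun r : ℝ => (r : ℂ)) := Complex.ofRealCLM.contDiff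
  fun_prop

theorem truncWave_eq_zero (η : ContDiffBump (0 : ℝ)) (κ : ℝ) {r : ℝ} (hr : η.rOut ≤ r) :
    truncWave η κ r = 0 := by
  rw [truncWave, η.zero_of_le_dist, Complex.ofReal_zero, zero_mul]
  rw [Real.dist_0_eq_abs]
  exact hr.trans (le_abs_self r)

theorem iteratedDeriv_wave (κ : ℝ) (n : ℕ) :
    iteratedDeriv n (fun r : ℝ => Complex.exp (Complex.I * κ * r)) =
      fun r : ℝ => (Complex.I * κ) ^ n * Complex.exp (Complex.I * κ * r) := by
  induction n with
  | zero => simp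
  | succ n ih =>
    rw [iteratedDeriv_succ, ih]
    funext r
    have d : HasDerivAt (fun r : ℝ => Complex.I * κ * (r : ℂ)) (Complex.I * κ) r := by
      simpa using (hasDerivAt_id r).ofReal_comp.const_mul (Complex.I * κ)
    rw [(d.cexp.const_mul _).deriv]
    ring

theorem exists_bound_iteratedDeriv {f : ℝ → ℂ} (h1 : ContDiff ℝ ∞ f) (h2 : HasCompactSupport f)
    (N : ℕ) : ∃ B : ℝ, 0 < B ∧ ∀ n ≤ N, ∀ r, ‖iteratedDeriv n f r‖ ≤ B := by
  have hb : ∀ n : ℕ, ∃ B : ℝ, ∀ r, ‖iteratedDeriv n f r‖ ≤ B := fun n => by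
    obtain ⟨C, hC⟩ := (h2.iteratedFDeriv (𝕜 := ℝ) n).exists_bound_of_continuous
      (h1.of_le (mod_cast le_top)).continuous_iteratedFDeriv'
    refine ⟨C, fun r => ?_⟩
    rw [← norm_iteratedFDeriv_eq_norm_iteratedDeriv]
    exact hC r
  choose B hB using hb
  refine ⟨1 + ∑ n ∈ Finset.range (N + 1), |B n|, by positivity, fun n hn r => ?_⟩
  have := Finset.single_le_sum (f := fun n => |B n|) (fun i _ => abs_nonneg (B i))
    (Finset.mem_range.mpr (Nat.lt_succ_of_le hn))
  linarith [hB n r, le_abs_self (B n)]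

theorem contDiff_bump_ofReal (η : ContDiffBump (0 : ℝ)) : ContDiff ℝ ∞ fun r : ℝ => (η r : ℂ) :=
  Complex.ofRealCLM.contDiff.comp η.contDiff

theorem exists_bound_iteratedDeriv_bump (η : ContDiffBump (0 : ℝ)) (N : ℕ) :
    ∃ B : ℝ, 0 < B ∧ ∀ n ≤ N, ∀ r, ‖iteratedDeriv n (fun r => (η r : ℂ)) r‖ ≤ B :=
  exists_bound_iteratedDeriv (contDiff_bump_ofReal η)
    (η.hasCompactSupport.comp_left (g := Complex.ofReal) Complex.ofReal_zero) N

theorem norm_iteratedDeriv_mul_wave_le {f : ℝ → ℂ} (hf : ContDiff ℝ ∞ f) {N : ℕ} {B : ℝ}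
    (hB : ∀ n ≤ N, ∀ r, ‖iteratedDeriv n f r‖ ≤ B) {κ : ℝ} (hκ : 0 ≤ κ)
    {n : ℕ} (hn : n ≤ N) (r : ℝ) :
    ‖iteratedDeriv n (fun r : ℝ => f r * Complex.exp (Complex.I * κ * r)) r‖ ≤
      B * (1 + κ) ^ n := by
  have h2 : ContDiff ℝ ∞ (fun r : ℝ => Complex.exp (Complex.I * κ * r)) := by
    have h2 : ContDiff ℝ ∞ (fun r : ℝ => (r : ℂ)) := Complex.ofRealCLM.contDiff
    fun_prop
  have h := norm_iteratedFDeriv_mul_le hf h2 r (n := n) (mod_cast le_top)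
  simp only [norm_iteratedFDeriv_eq_norm_iteratedDeriv, iteratedDeriv_wave] at h
  refine h.trans ?_
  rw [add_pow, Finset.mul_sum]
  refine Finset.sum_le_sum fun i hi => ?_
  have hw : ‖(Complex.I * κ) ^ (n - i) * Complex.exp (Complex.I * κ * r)‖ = κ ^ (n - i) := by
    rw [show Complex.I * κ * r = ((κ * r : ℝ) : ℂ) * Complex.I by push_cast; ring, norm_mul,
      Complex.norm_exp_ofReal_mul_I]
    simp [abs_of_nonneg hκ]
  have hi' := hB i ((Finset.mem_range_succ_iff.mp hi).trans hn) r
  rw [hw, one_pow, one_mul]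
  have : (0 : ℝ) ≤ (n.choose i : ℝ) * κ ^ (n - i) := by positivity
  nlinarith

theorem norm_iteratedDeriv_truncWave_le (η : ContDiffBump (0 : ℝ)) {N : ℕ} {B : ℝ}
    (hB : ∀ n ≤ N, ∀ r, ‖iteratedDeriv n (fun r => (η r : ℂ)) r‖ ≤ B) {κ : ℝ} (hκ : 0 ≤ κ)
    {n : ℕ} (hn : n ≤ N) (r : ℝ) :
    ‖iteratedDeriv n (truncWave η κ) r‖ ≤ B * (1 + κ) ^ n :=
  norm_iteratedDeriv_mul_wave_le (contDiff_bump_ofReal η) hB hκ hn r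

/-- The sine transform of the truncated wave is `O(σ/κ)`: integration by parts moves the derivative
from `e^{iκr}` to `η(r) sin(σr)`, whose derivative is `O(σ)` on `[0, A]` because of
`|sin(σr)| ≤ σr`. -/
theorem mul_norm_sine_truncWave_le (η : ContDiffBump (0 : ℝ)) {B : ℝ}
    (hB : ∀ n ≤ 1, ∀ r, ‖iteratedDeriv n (fun r => (η r : ℂ)) r‖ ≤ B) {A : ℝ} (hA : 0 ≤ A)
    (hAη : η.rOut ≤ A) {κ : ℝ} (hκ : 0 ≤ κ) {σ : ℝ} (hσ : 0 ≤ σ) :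
    κ * ‖∫ r in 0..A, (Real.sin (σ * r) : ℂ) * truncWave η κ r‖ ≤ A * ((A + 1) * B * σ) := by
  have h1 : ContDiff ℝ ∞ (fun r : ℝ => (η r : ℂ)) := Complex.ofRealCLM.contDiff.comp η.contDiff
  have h1c := h1.continuous
  have hdc : Continuous (deriv fun r : ℝ => (η r : ℂ)) := h1.continuous_deriv (by simp)
  have hB0 : ∀ r, ‖(η r : ℂ)‖ ≤ B := fun r => by simpa using hB 0 (by norm_num) r
  have hB1 : ∀ r, ‖deriv (fun r => (η r : ℂ)) r‖ ≤ B := fun r => by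
    simpa [iteratedDeriv_one] using hB 1 le_rfl r
  have dw : ∀ r : ℝ, HasDerivAt (fun r : ℝ => Complex.exp (Complex.I * κ * r))
      (Complex.exp (Complex.I * κ * r) * (Complex.I * κ)) r := fun r => by
    have d : HasDerivAt (fun r : ℝ => Complex.I * κ * (r : ℂ)) (Complex.I * κ) r := by
      simpa using (hasDerivAt_id r).ofReal_comp.const_mul (Complex.I * κ)
    exact d.cexp
  have du : ∀ r : ℝ, HasDerivAt (fun r : ℝ => (Real.sin (σ * r) : ℂ) * (η r : ℂ))
      (Real.cos (σ * r) * σ * (η r : ℂ) + Real.sin (σ * r) * deriv (fun r => (η r : ℂ)) r) r :=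
    fun r => (hasDerivAt_sin_ofReal σ r).mul
      (h1.differentiable (by simp) r).hasDerivAt
  have h := intervalIntegral.integral_mul_deriv_eq_deriv_mul (a := 0) (b := A)
    (fun r _ => du r) (fun r _ => dw r)
    (Continuous.intervalIntegrable (by fun_prop) _ _)
    (Continuous.intervalIntegrable (by fun_prop) _ _)
  have hη0 : (η A : ℂ) = 0 := by
    rw [η.zero_of_le_dist, Complex.ofReal_zero]
    rw [Real.dist_0_eq_abs]
    exact hAη.trans (le_abs_self A)
  simp only [hη0, mul_zero, Real.sin_zero, Complex.ofReal_zero, zero_mul, sub_zero,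
    zero_sub] at h
  have e : κ * ‖∫ r in 0..A, (Real.sin (σ * r) : ℂ) * truncWave η κ r‖ =
      ‖∫ r in 0..A, (Real.sin (σ * r) : ℂ) * (η r : ℂ) *
        (Complex.exp (Complex.I * κ * r) * (Complex.I * κ))‖ := by
    have : ∀ r : ℝ, (Real.sin (σ * r) : ℂ) * (η r : ℂ) *
        (Complex.exp (Complex.I * κ * r) * (Complex.I * κ)) =
        (Complex.I * κ) * ((Real.sin (σ * r) : ℂ) * truncWave η κ r) := fun r => by
      rw [truncWave]
      ring
    simp only [this]
    rw [intervalIntegral.integral_const_mul, norm_mul]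
    simp [abs_of_nonneg hκ]
  rw [e, h, norm_neg]
  have hle := intervalIntegral.norm_integral_le_of_norm_le_const (a := 0) (b := A)
    (C := (A + 1) * B * σ) (f := fun r : ℝ => (Real.cos (σ * r) * σ * (η r : ℂ) +
      Real.sin (σ * r) * deriv (fun r => (η r : ℂ)) r) * Complex.exp (Complex.I * κ * r))
    fun r hr => by
      rw [Set.uIoc_of_le hA] at hr
      rw [show Complex.I * κ * r = ((κ * r : ℝ) : ℂ) * Complex.I by push_cast; ring, norm_mul,
        Complex.norm_exp_ofReal_mul_I, mul_one]
      refine (norm_add_le _ _).trans ?_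
      have n1 : ‖((Real.sin (σ * r) : ℝ) : ℂ)‖ = |Real.sin (σ * r)| := Complex.norm_real _
      have n2 : ‖((Real.cos (σ * r) : ℝ) : ℂ)‖ = |Real.cos (σ * r)| := Complex.norm_real _
      have n3 : ‖(σ : ℂ)‖ = σ := by rw [Complex.norm_real, Real.norm_eq_abs, abs_of_nonneg hσ]
      rw [norm_mul, norm_mul, norm_mul, n1, n2, n3]
      have hs : |Real.sin (σ * r)| ≤ σ * A := by
        refine Real.abs_sin_le_abs.trans ?_
        rw [abs_of_nonneg (mul_nonneg hσ hr.1.le)]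
        exact mul_le_mul_of_nonneg_left hr.2 hσ
      have hc : |Real.cos (σ * r)| * σ ≤ 1 * σ :=
        mul_le_mul_of_nonneg_right (Real.abs_cos_le_one _) hσ
      have t1 := mul_le_mul hc (hB0 r) (norm_nonneg _) (by linarith)
      have t2 := mul_le_mul hs (hB1 r) (norm_nonneg _) (mul_nonneg hσ hA)
      linarith
  rwa [sub_zero, abs_of_nonneg hA, mul_comm _ A] at hle

/-- The three decay estimates for the sine transform of a truncated wave, in a common form. -/
theorem pow_mul_norm_sine_truncWave_le (η : ContDiffBump (0 : ℝ)) {B : ℝ}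
    (hB : ∀ n ≤ 1, ∀ r, ‖iteratedDeriv n (fun r => (η r : ℂ)) r‖ ≤ B) {A : ℝ} (hA : 0 ≤ A)
    (hAη : η.rOut ≤ A) {κ : ℝ} (hκ : 0 ≤ κ) {σ : ℝ} (hσ : 0 ≤ σ) {m : ℕ} (hm : m ≤ 2) :
    κ * (σ ^ m * ‖∫ r in 0..A, (Real.sin (σ * r) : ℂ) * truncWave η κ r‖) ≤
      (1 + A) ^ 2 * B * (1 + κ) ^ m * σ := by
  have hB0 : 0 ≤ B := (norm_nonneg _).trans (hB 0 (by norm_num) 0)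
  have hd : ∀ n ≤ 1, ∀ r, ‖iteratedDeriv n (truncWave η κ) r‖ ≤ B * (1 + κ) ^ n :=
    fun n hn r => norm_iteratedDeriv_truncWave_le η hB hκ hn r
  have hd0 : ∀ r, ‖truncWave η κ r‖ ≤ B := fun r => by simpa using hd 0 (by norm_num) r
  have hd1 : ∀ r, ‖deriv (truncWave η κ) r‖ ≤ B * (1 + κ) := fun r => by
    simpa [iteratedDeriv_one] using hd 1 le_rfl r
  have hS := norm_sine_integral_le hA hd0 σ
  have hBσ : 0 ≤ B * σ := mul_nonneg hB0 hσ
  interval_cases m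
  · have := mul_norm_sine_truncWave_le η hB hA hAη hκ hσ
    simp only [pow_zero, one_mul, mul_one]
    nlinarith [mul_nonneg hA hBσ]
  · simp only [pow_one]
    have h1 : κ * (σ * ‖∫ r in 0..A, (Real.sin (σ * r) : ℂ) * truncWave η κ r‖) ≤
      κ * (σ * (A * B)) := by gcongr
    have h2 : (κ * σ * B) * A ≤ (κ * σ * B) * (1 + A) ^ 2 :=
      mul_le_mul_of_nonneg_left (by nlinarith) (by positivity)
    have h3 : 0 ≤ (1 + A) ^ 2 * B * σ := by positivity
    nlinarith
  · have e := mul_sine_integral ((contDiff_truncWave η κ).of_le (by simp))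
      (truncWave_eq_zero η κ hAη) σ
    have hC := norm_cosine_integral_le hA hd1 σ
    have hσS : σ * ‖∫ r in 0..A, (Real.sin (σ * r) : ℂ) * truncWave η κ r‖ ≤
        B + A * (B * (1 + κ)) := by
      have : σ * ‖∫ r in 0..A, (Real.sin (σ * r) : ℂ) * truncWave η κ r‖ =
          ‖(σ : ℂ) * ∫ r in 0..A, (Real.sin (σ * r) : ℂ) * truncWave η κ r‖ := by
        rw [norm_mul, Complex.norm_real, Real.norm_eq_abs, abs_of_nonneg hσ]
      rw [this, e]
      exact (norm_add_le _ _).trans (add_le_add (hd0 0) hC)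
    have hle : B + A * (B * (1 + κ)) ≤ (1 + A) ^ 2 * B * (1 + κ) := by
      have : 0 ≤ B * (1 + κ) := by positivity
      nlinarith [mul_nonneg hB0 hκ, mul_nonneg hA this, mul_nonneg hA (mul_nonneg hA this)]
    calc κ * (σ ^ 2 * ‖∫ r in 0..A, (Real.sin (σ * r) : ℂ) * truncWave η κ r‖)
        = (κ * σ) * (σ * ‖∫ r in 0..A, (Real.sin (σ * r) : ℂ) * truncWave η κ r‖) := by ring
      _ ≤ (κ * σ) * ((1 + A) ^ 2 * B * (1 + κ)) :=
        mul_le_mul_of_nonneg_left (hσS.trans hle) (by positivity)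
      _ ≤ ((1 + κ) * σ) * ((1 + A) ^ 2 * B * (1 + κ)) := by
        gcongr
        linarith
      _ = (1 + A) ^ 2 * B * (1 + κ) ^ 2 * σ := by ring

/-! ### Second derivatives of radial functions and their Fourier transforms -/

theorem hasFDerivAt_sqrt_norm_sq_add {t : ℝ} {x : E3} (hx : 0 < ‖x‖ ^ 2 + t) :
    HasFDerivAt (fun y : E3 => √(‖y‖ ^ 2 + t)) ((1 / √(‖x‖ ^ 2 + t)) • innerSL ℝ x) x := by
  have h1 : HasFDerivAt (fun y : E3 => ‖y‖ ^ 2 + t) (2 • innerSL ℝ x) x :=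
    (hasStrictFDerivAt_norm_sq x).hasFDerivAt.add_const t
  have h2 := h1.sqrt hx.ne'
  convert! h2 using 1
  ext v
  have : 0 < √(‖x‖ ^ 2 + t) := Real.sqrt_pos.mpr hx
  simp
  field_simp

theorem partialDeriv_radial {q : ℝ → ℂ} (hq : Differentiable ℝ q) {t : ℝ} {x : E3}
    (hx : 0 < ‖x‖ ^ 2 + t) (j : Fin 3) :
    DifferentiableAt ℝ (fun y : E3 => q √(‖y‖ ^ 2 + t)) x ∧
    partialDeriv j (fun y : E3 => q √(‖y‖ ^ 2 + t)) x =
      deriv q √(‖x‖ ^ 2 + t) * ((x j / √(‖x‖ ^ 2 + t) : ℝ) : ℂ) := by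
  have h := (hq √(‖x‖ ^ 2 + t)).hasDerivAt.hasFDerivAt.comp x (hasFDerivAt_sqrt_norm_sq_add hx)
  refine ⟨h.differentiableAt, ?_⟩
  rw [partialDeriv, show (fun y : E3 => q √(‖y‖ ^ 2 + t)) = q ∘ fun y : E3 => √(‖y‖ ^ 2 + t)
    from rfl, h.fderiv]
  simp [EuclideanSpace.inner_single_right]
  ring

/-- The Hessian `∂ᵢ∂ⱼ` of the regularised radial function `x ↦ q(ρ)`, `ρ = √(|x|² + t)`. At `t = 0`
this is the Hessian of `q(|x|)` away from the origin. -/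
def radialHessian (q : ℝ → ℂ) (t : ℝ) (i j : Fin 3) (x : E3) : ℂ :=
  deriv (deriv q) √(‖x‖ ^ 2 + t) * ((x i * x j / √(‖x‖ ^ 2 + t) ^ 2 : ℝ) : ℂ) +
    deriv q √(‖x‖ ^ 2 + t) * (((if i = j then 1 else 0) / √(‖x‖ ^ 2 + t) -
      x i * x j / √(‖x‖ ^ 2 + t) ^ 3 : ℝ) : ℂ)

theorem partialDeriv_partialDeriv_radial {q : ℝ → ℂ} (hq : ContDiff ℝ 2 q) {t : ℝ} {x : E3}
    (hx : 0 < ‖x‖ ^ 2 + t) (i j : Fin 3) :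
    partialDeriv i (partialDeriv j fun y : E3 => q √(‖y‖ ^ 2 + t)) x =
      radialHessian q t i j x := by
  have hq1 : Differentiable ℝ q := hq.differentiable (by simp)
  have hq2 : Differentiable ℝ (deriv q) :=
    (ContDiff.iterate_deriv' 1 1 hq).differentiable (by simp)
  have hopen : ∀ᶠ y in nhds x, 0 < ‖y‖ ^ 2 + t :=
    (by fun_prop : Continuous fun y : E3 => ‖y‖ ^ 2 + t).continuousAt.eventually (lt_mem_nhds hx)
  have hev : partialDeriv j (fun y : E3 => q √(‖y‖ ^ 2 + t)) =ᶠ[nhds x]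
      fun y => deriv q √(‖y‖ ^ 2 + t) * ((y j / √(‖y‖ ^ 2 + t) : ℝ) : ℂ) :=
    hopen.mono fun y hy => (partialDeriv_radial hq1 hy j).2
  have hρ : 0 < √(‖x‖ ^ 2 + t) := Real.sqrt_pos.mpr hx
  obtain ⟨hA, hA'⟩ := partialDeriv_radial hq2 hx i
  have hj : HasFDerivAt (fun y : E3 => y j) (EuclideanSpace.proj (𝕜 := ℝ) j : E3 →L[ℝ] ℝ) x :=
    (EuclideanSpace.proj (𝕜 := ℝ) j : E3 →L[ℝ] ℝ).hasFDerivAt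
  have hB := Complex.ofRealCLM.hasFDerivAt.comp x
    (hj.mul ((hasDerivAt_inv hρ.ne').hasFDerivAt.comp x (hasFDerivAt_sqrt_norm_sq_add hx)))
  have hAB := hA.hasFDerivAt.mul hB
  have e1 : (fun y : E3 => deriv q √(‖y‖ ^ 2 + t) * ((y j / √(‖y‖ ^ 2 + t) : ℝ) : ℂ)) =
      (fun y : E3 => deriv q √(‖y‖ ^ 2 + t)) * (Complex.ofRealCLM ∘ ((fun y : E3 => y j) *
        (Inv.inv ∘ fun y : E3 => √(‖y‖ ^ 2 + t)))) := by
    funext y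
    simp [div_eq_mul_inv]
  rw [partialDeriv] at hA'
  rw [partialDeriv, hev.fderiv_eq, e1, hAB.fderiv]
  have hρ' : ((√(‖x‖ ^ 2 + t) : ℝ) : ℂ) ≠ 0 := by exact_mod_cast hρ.ne'
  simp only [add_apply, smul_apply, hA', radialHessian]
  by_cases hij : i = j
  · subst hij
    simp [EuclideanSpace.inner_single_right]
    field_simp
    ring
  · simp [EuclideanSpace.inner_single_right, hij, Ne.symm hij]
    field_simp
    ring

theorem norm_radialHessian_le {q : ℝ → ℂ} {B : ℝ} (h1 : ∀ r, ‖deriv q r‖ ≤ B)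
    (h2 : ∀ r, ‖deriv (deriv q) r‖ ≤ B) {t : ℝ} (ht : 0 ≤ t) (i j : Fin 3) {x : E3}
    (hx : x ≠ 0) : ‖radialHessian q t i j x‖ ≤ B * (1 + 2 / ‖x‖) := by
  have hn : 0 < ‖x‖ := norm_pos_iff.mpr hx
  have hle : ‖x‖ ≤ √(‖x‖ ^ 2 + t) := Real.le_sqrt_of_sq_le (by linarith)
  set ρ := √(‖x‖ ^ 2 + t)
  have hρ : 0 < ρ := hn.trans_le hle
  have hB : 0 ≤ B := (norm_nonneg _).trans (h1 0)
  have hi : |x i| ≤ ρ := (PiLp.norm_apply_le x i).trans hle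
  have hj : |x j| ≤ ρ := (PiLp.norm_apply_le x j).trans hle
  have hij : |x i * x j| ≤ ρ ^ 2 := by
    rw [abs_mul, pow_two]
    exact mul_le_mul hi hj (abs_nonneg _) hρ.le
  have b1 : ‖((x i * x j / ρ ^ 2 : ℝ) : ℂ)‖ ≤ 1 := by
    rw [Complex.norm_real, Real.norm_eq_abs, abs_div, abs_of_pos (pow_pos hρ 2)]
    exact div_le_one_of_le₀ hij (by positivity)
  have b2 : ‖(((if i = j then 1 else 0) / ρ - x i * x j / ρ ^ 3 : ℝ) : ℂ)‖ ≤ 2 / ‖x‖ := by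
    rw [Complex.norm_real, Real.norm_eq_abs]
    have c1 : |(if i = j then 1 else 0) / ρ| ≤ 1 / ρ := by
      rw [abs_div, abs_of_pos hρ]
      gcongr
      split_ifs <;> simp
    have c2 : |x i * x j / ρ ^ 3| ≤ 1 / ρ := by
      rw [abs_div, abs_of_pos (pow_pos hρ 3), div_le_div_iff₀ (by positivity) hρ]
      nlinarith
    have c3 : 1 / ρ ≤ 1 / ‖x‖ := one_div_le_one_div_of_le hn hle
    calc _ ≤ 1 / ρ + 1 / ρ := (abs_sub _ _).trans (add_le_add c1 c2)
      _ ≤ 2 / ‖x‖ := by rw [show (2 : ℝ) / ‖x‖ = 1 / ‖x‖ + 1 / ‖x‖ by ring]; gcongr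
  calc ‖radialHessian q t i j x‖ ≤ B * 1 + B * (2 / ‖x‖) := by
        refine norm_add_le_of_le ?_ ?_ <;> rw [norm_mul]
        · exact mul_le_mul (h2 _) b1 (norm_nonneg _) hB
        · exact mul_le_mul (h1 _) b2 (norm_nonneg _) hB
    _ = _ := by ring

theorem radialHessian_eq_zero {q : ℝ → ℂ} {a : ℝ} (h0 : ∀ r, a ≤ r → q r = 0) {t : ℝ}
    (ht : 0 ≤ t) (i j : Fin 3) {x : E3} (hx : a < ‖x‖) : radialHessian q t i j x = 0 := by
  have hle : a < √(‖x‖ ^ 2 + t) := hx.trans_le (Real.le_sqrt_of_sq_le (by linarith))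
  have hev : q =ᶠ[nhds √(‖x‖ ^ 2 + t)] fun _ => 0 :=
    (lt_mem_nhds hle).mono fun r hr => h0 r hr.le
  have d1 : deriv q √(‖x‖ ^ 2 + t) = 0 := by simp [hev.deriv_eq]
  have d2 : deriv (deriv q) √(‖x‖ ^ 2 + t) = 0 := by
    rw [hev.deriv.deriv_eq]
    simp
  simp [radialHessian, d1, d2]

/-- The truncated Coulomb kernel `1/|x|`, which dominates the entries of the Kupradze matrix. -/
def coulomb (A : ℝ) : E3 → ℝ := (Metric.ball 0 A).indicator fun x => ‖x‖⁻¹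

theorem integrable_coulomb (A : ℝ) : Integrable (coulomb A) := by
  rw [coulomb, integrable_indicator_iff measurableSet_ball,
    integrableOn_fun_norm_addHaar volume (f := fun r : ℝ => r⁻¹)]
  have hc : IntegrableOn (fun y : ℝ => y) (Set.Ioo 0 A) :=
    (continuous_id.integrableOn_Icc).mono_set Set.Ioo_subset_Icc_self
  refine hc.congr_fun (fun y hy => ?_) measurableSet_Ioo
  have := hy.1.ne'
  simp
  field_simp

theorem memLp_coulomb (A : ℝ) : MemLp (coulomb A) 2 := by
  rw [memLp_two_iff_integrable_sq (integrable_coulomb A).aestronglyMeasurable]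
  have e : (fun x => coulomb A x ^ 2) =
      (Metric.ball (0 : E3) A).indicator fun x => ‖x‖⁻¹ ^ 2 := by
    funext x
    by_cases hx : x ∈ Metric.ball (0 : E3) A <;> simp [coulomb, hx]
  rw [e, integrable_indicator_iff measurableSet_ball,
    integrableOn_fun_norm_addHaar volume (f := fun r : ℝ => r⁻¹ ^ 2)]
  have hc : IntegrableOn (fun _ : ℝ => (1 : ℝ)) (Set.Ioo 0 A) :=
    (continuous_const.integrableOn_Icc).mono_set Set.Ioo_subset_Icc_self
  refine hc.congr_fun (fun y hy => ?_) measurableSet_Ioo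
  have := hy.1.ne'
  simp
  field_simp

theorem norm_radialHessian_le_coulomb {q : ℝ → ℂ} {B : ℝ} (h1 : ∀ r, ‖deriv q r‖ ≤ B)
    (h2 : ∀ r, ‖deriv (deriv q) r‖ ≤ B) {a A : ℝ} (haA : a < A) (h0 : ∀ r, a ≤ r → q r = 0)
    {t : ℝ} (ht : 0 ≤ t) (i j : Fin 3) {x : E3} (hx : x ≠ 0) :
    ‖radialHessian q t i j x‖ ≤ B * (A + 2) * coulomb A x := by
  have hn : 0 < ‖x‖ := norm_pos_iff.mpr hx
  by_cases hA : x ∈ Metric.ball (0 : E3) A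
  · rw [coulomb, Set.indicator_of_mem hA]
    refine (norm_radialHessian_le h1 h2 ht i j hx).trans ?_
    have hB : 0 ≤ B := (norm_nonneg _).trans (h1 0)
    rw [mul_assoc]
    refine mul_le_mul_of_nonneg_left ?_ hB
    have : ‖x‖ < A := by simpa using hA
    rw [← div_eq_mul_inv, le_div_iff₀ hn, add_mul, div_mul_cancel₀ _ hn.ne']
    linarith
  · rw [radialHessian_eq_zero h0 ht i j (haA.trans_le (by simpa using hA)), norm_zero, coulomb,
      Set.indicator_of_notMem hA, mul_zero]

theorem measurable_radialHessian {q : ℝ → ℂ} (hq : ContDiff ℝ 2 q) (t : ℝ) (i j : Fin 3) :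
    Measurable (radialHessian q t i j) := by
  have h1 : Measurable (deriv q) := (hq.continuous_deriv (by simp)).measurable
  have h2 : Measurable (deriv (deriv q)) := measurable_deriv _
  unfold radialHessian
  fun_prop

theorem fourier_radialHessian_of_pos {q : ℝ → ℂ} (hq : ContDiff ℝ ∞ q) {a : ℝ}
    (h0 : ∀ r, a ≤ r → q r = 0) {t : ℝ} (ht : 0 < t) (i j : Fin 3) (ξ : E3) :
    𝓕 (radialHessian q t i j) ξ =
      (2 * Real.pi * Complex.I) ^ 2 * ξ i * ξ j * 𝓕 (fun x : E3 => q √(‖x‖ ^ 2 + t)) ξ := by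
  have hpos : ∀ x : E3, 0 < ‖x‖ ^ 2 + t := fun x => by positivity
  have hsm : ContDiff ℝ ∞ fun x : E3 => q √(‖x‖ ^ 2 + t) :=
    hq.comp (((contDiff_norm_sq ℝ).add contDiff_const).sqrt fun x => (hpos x).ne')
  have hcs : HasCompactSupport fun x : E3 => q √(‖x‖ ^ 2 + t) := by
    refine HasCompactSupport.intro (isCompact_closedBall (0 : E3) a) fun x hx => h0 _ ?_
    have hx' : a < ‖x‖ := by simpa using hx
    exact hx'.le.trans (Real.le_sqrt_of_sq_le (by linarith))
  set Φ : 𝓢(E3, ℂ) := hcs.toSchwartzMap hsm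
  have hΦ : (Φ : E3 → ℂ) = fun x : E3 => q √(‖x‖ ^ 2 + t) := rfl
  have hH : radialHessian q t i j = (∂_{EuclideanSpace.single i (1 : ℝ)}
      (∂_{EuclideanSpace.single j (1 : ℝ)} Φ : 𝓢(E3, ℂ)) : 𝓢(E3, ℂ)) := by
    funext x
    rw [← partialDeriv_partialDeriv_radial (hq.of_le (by exact WithTop.coe_le_coe.mpr le_top)) (hpos x) i j, ← hΦ]
    rfl
  have ht1 : ∀ l : Fin 3, (inner ℝ · (EuclideanSpace.single l (1 : ℝ)) : E3 → ℝ).HasTemperateGrowth :=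
    fun l => by fun_prop
  rw [hH, ← hΦ, ← SchwartzMap.fourier_coe, ← SchwartzMap.fourier_coe,
    SchwartzMap.fourier_lineDerivOp_eq, smul_apply, SchwartzMap.smulLeftCLM_apply_apply (ht1 i),
    SchwartzMap.fourier_lineDerivOp_eq, smul_apply, SchwartzMap.smulLeftCLM_apply_apply (ht1 j)]
  simp [EuclideanSpace.inner_single_right]
  ring

theorem tendsto_fourier_of_dominated {F : ℕ → E3 → ℂ} {f : E3 → ℂ} {g : E3 → ℝ}
    (hF : ∀ n, AEStronglyMeasurable (F n)) (hg : Integrable g)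
    (hle : ∀ n, ∀ᵐ x, ‖F n x‖ ≤ g x)
    (hlim : ∀ᵐ x, Filter.Tendsto (fun n => F n x) Filter.atTop (nhds (f x))) (ξ : E3) :
    Filter.Tendsto (fun n => 𝓕 (F n) ξ) Filter.atTop (nhds (𝓕 f ξ)) := by
  simp only [Real.fourier_eq']
  refine tendsto_integral_of_dominated_convergence g (fun n => ?_) hg (fun n => ?_) ?_
  · exact (Continuous.aestronglyMeasurable (f := fun v : E3 =>
      Complex.exp ((-2 * Real.pi * inner ℝ v ξ : ℝ) * Complex.I)) (by fun_prop)).smul (hF n)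
  · filter_upwards [hle n] with x hx
    rwa [norm_smul, Complex.norm_exp_ofReal_mul_I, one_mul]
  · filter_upwards [hlim] with x hx
    exact hx.const_smul _

/-- The pointwise Hessian of a radial function `q(|x|)`, which is singular at the origin, is its
distributional Hessian: its Fourier transform is that of `q(|x|)` times the symbol. -/
theorem fourier_radialHessian {q : ℝ → ℂ} (hq : ContDiff ℝ ∞ q) {B : ℝ}
    (hB : ∀ n ≤ 2, ∀ r, ‖iteratedDeriv n q r‖ ≤ B) {a A : ℝ} (haA : a < A)
    (h0 : ∀ r, a ≤ r → q r = 0) (i j : Fin 3) (ξ : E3) :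
    𝓕 (radialHessian q 0 i j) ξ =
      (2 * Real.pi * Complex.I) ^ 2 * ξ i * ξ j * 𝓕 (fun x : E3 => q ‖x‖) ξ := by
  have hq2 : ContDiff ℝ 2 q := hq.of_le (by exact WithTop.coe_le_coe.mpr le_top)
  have b0 : ∀ r, ‖q r‖ ≤ B := fun r => by simpa using hB 0 (by norm_num) r
  have b1 : ∀ r, ‖deriv q r‖ ≤ B := fun r => by simpa [iteratedDeriv_one] using hB 1 (by norm_num) r
  have b2 : ∀ r, ‖deriv (deriv q) r‖ ≤ B := fun r => by
    simpa [iteratedDeriv_succ, iteratedDeriv_zero] using hB 2 le_rfl r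
  have hBpos : 0 ≤ B := (norm_nonneg _).trans (b0 0)
  set t : ℕ → ℝ := fun n => 1 / ((n : ℝ) + 1)
  have htpos : ∀ n, 0 < t n := fun n => by positivity
  have htlim : Filter.Tendsto t Filter.atTop (nhds 0) := tendsto_one_div_add_atTop_nhds_zero_nat
  have hne : ∀ᵐ x : E3, x ≠ 0 := Measure.ae_ne volume 0
  have hρlim : ∀ x : E3, Filter.Tendsto (fun n => √(‖x‖ ^ 2 + t n)) Filter.atTop
      (nhds √(‖x‖ ^ 2 + 0)) := fun x => (htlim.const_add _).sqrt
  have lim1 : Filter.Tendsto (fun n => 𝓕 (radialHessian q (t n) i j) ξ) Filter.atTop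
      (nhds (𝓕 (radialHessian q 0 i j) ξ)) := by
    refine tendsto_fourier_of_dominated
      (fun n => (measurable_radialHessian hq2 _ i j).aestronglyMeasurable)
      ((integrable_coulomb A).const_mul (B * (A + 2))) (fun n => ?_) ?_ ξ
    · filter_upwards [hne] with x hx
      exact norm_radialHessian_le_coulomb b1 b2 haA h0 (htpos n).le i j hx
    · filter_upwards [hne] with x hx
      have hρ : √(‖x‖ ^ 2 + 0) ≠ 0 := by simpa using hx
      have hd1 : Continuous (deriv q) := hq2.continuous_deriv (by simp)
      have hd2 : Continuous (deriv (deriv q)) :=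
        (ContDiff.iterate_deriv' 1 1 hq2).continuous_deriv le_rfl
      have l := hρlim x
      have c1 := tendsto_const_nhds (x := x i * x j) (f := Filter.atTop (α := ℕ))
      have c2 := tendsto_const_nhds (x := if i = j then (1 : ℝ) else 0) (f := Filter.atTop (α := ℕ))
      exact (((hd2.tendsto _).comp l).mul ((Complex.continuous_ofReal.tendsto _).comp
        (c1.div (l.pow 2) (pow_ne_zero 2 hρ)))).add
        (((hd1.tendsto _).comp l).mul ((Complex.continuous_ofReal.tendsto _).comp
        ((c2.div l hρ).sub (c1.div (l.pow 3) (pow_ne_zero 3 hρ)))))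
  have lim2 : Filter.Tendsto (fun n => 𝓕 (fun x : E3 => q √(‖x‖ ^ 2 + t n)) ξ) Filter.atTop
      (nhds (𝓕 (fun x : E3 => q ‖x‖) ξ)) := by
    refine tendsto_fourier_of_dominated (g := (Metric.closedBall (0 : E3) a).indicator fun _ => B)
      (fun n => ?_) ?_ (fun n => Filter.Eventually.of_forall fun x => ?_)
      (Filter.Eventually.of_forall fun x => ?_) ξ
    · exact (hq.continuous.comp (by fun_prop)).aestronglyMeasurable
    · rw [integrable_indicator_iff measurableSet_closedBall]
      exact integrableOn_const (isCompact_closedBall (0 : E3) a).measure_lt_top.ne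
    · by_cases hx : x ∈ Metric.closedBall (0 : E3) a
      · rw [Set.indicator_of_mem hx]
        exact b0 _
      · have hx' : a < ‖x‖ := by simpa using hx
        have := htpos n
        rw [Set.indicator_of_notMem hx, h0 _ (hx'.le.trans (Real.le_sqrt_of_sq_le (by linarith))),
          norm_zero]
    · have l := hρlim x
      simp only [add_zero, Real.sqrt_sq (norm_nonneg x)] at l
      exact (hq.continuous.tendsto _).comp l
  have lim3 := lim2.const_mul ((2 * Real.pi * Complex.I) ^ 2 * ξ i * ξ j)
  simp only [← fourier_radialHessian_of_pos hq h0 (htpos _)] at lim3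
  exact tendsto_nhds_unique lim1 lim3

/-! ### The truncated Kupradze matrix -/

/-- The entire function `(e^{iκ₂r} - e^{iκ₁r})/r`, with its removable singularity removed. -/
def waveQuot (κ₁ κ₂ r : ℝ) : ℂ :=
  dslope (fun z : ℂ => Complex.exp (Complex.I * κ₂ * z) - Complex.exp (Complex.I * κ₁ * z)) 0 r

theorem mul_waveQuot (κ₁ κ₂ r : ℝ) : (r : ℂ) * waveQuot κ₁ κ₂ r =
    Complex.exp (Complex.I * κ₂ * r) - Complex.exp (Complex.I * κ₁ * r) := by
  have h := sub_smul_dslope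
    (fun z : ℂ => Complex.exp (Complex.I * κ₂ * z) - Complex.exp (Complex.I * κ₁ * z)) 0 (r : ℂ)
  simpa [waveQuot] using h

theorem contDiff_waveQuot (κ₁ κ₂ : ℝ) : ContDiff ℝ ∞ (waveQuot κ₁ κ₂) := by
  have h1 : Differentiable ℂ (dslope
      (fun z : ℂ => Complex.exp (Complex.I * κ₂ * z) - Complex.exp (Complex.I * κ₁ * z)) 0) := by
    rw [← differentiableOn_univ, Complex.differentiableOn_dslope Filter.univ_mem]
    fun_prop
  have h2 : ContDiff ℂ ∞ (dslope
      (fun z : ℂ => Complex.exp (Complex.I * κ₂ * z) - Complex.exp (Complex.I * κ₁ * z)) 0) :=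
    h1.contDiff
  exact (h2.restrict_scalars ℝ).comp Complex.ofRealCLM.contDiff

/-- The smooth profile `q` with `q(|x|) = η(|x|) (e^{iκ₂|x|} - e^{iκ₁|x|})/|x|`. -/
def truncQuot (η : ContDiffBump (0 : ℝ)) (κ₁ κ₂ r : ℝ) : ℂ := η r * waveQuot κ₁ κ₂ r

theorem contDiff_truncQuot (η : ContDiffBump (0 : ℝ)) (κ₁ κ₂ : ℝ) :
    ContDiff ℝ ∞ (truncQuot η κ₁ κ₂) :=
  (contDiff_bump_ofReal η).mul (contDiff_waveQuot κ₁ κ₂)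

theorem bump_eq_zero (η : ContDiffBump (0 : ℝ)) {r : ℝ} (hr : η.rOut ≤ |r|) : (η r : ℂ) = 0 := by
  rw [η.zero_of_le_dist (by rwa [Real.dist_0_eq_abs]), Complex.ofReal_zero]

theorem truncQuot_eq_zero (η : ContDiffBump (0 : ℝ)) (κ₁ κ₂ : ℝ) {r : ℝ} (hr : η.rOut ≤ |r|) :
    truncQuot η κ₁ κ₂ r = 0 := by
  rw [truncQuot, bump_eq_zero η hr, zero_mul]

theorem hasCompactSupport_truncQuot (η : ContDiffBump (0 : ℝ)) (κ₁ κ₂ : ℝ) :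
    HasCompactSupport (truncQuot η κ₁ κ₂) := by
  refine HasCompactSupport.intro (isCompact_closedBall (0 : ℝ) η.rOut) fun r hr => ?_
  have : η.rOut < |r| := by simpa using hr
  exact truncQuot_eq_zero η κ₁ κ₂ this.le

theorem mul_truncQuot (η : ContDiffBump (0 : ℝ)) (κ₁ κ₂ r : ℝ) :
    (r : ℂ) * truncQuot η κ₁ κ₂ r = truncWave η κ₂ r - truncWave η κ₁ r := by
  rw [truncQuot, mul_left_comm, mul_waveQuot, truncWave, truncWave, mul_sub]

/-- The entries of the Kupradze matrix, cut off smoothly in `|x|`: both spherical waves are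
multiplied by `η(|x|)` before the derivatives are taken. -/
def truncKernel (η : ContDiffBump (0 : ℝ)) (μ κ₁ κ₂ : ℝ) (i j : Fin 3) (x : E3) : ℂ :=
  1 / (4 * Real.pi * μ : ℂ) * ((if i = j then truncWave η κ₂ ‖x‖ / ‖x‖ else 0) +
    1 / (κ₂ : ℂ) ^ 2 * radialHessian (truncQuot η κ₁ κ₂) 0 i j x)

/-- The cut-off does not change the Kupradze matrix where `η = 1`. -/
theorem kupradzeMatrix_eq_truncKernel (η : ContDiffBump (0 : ℝ)) (lam μ k : ℝ) (i j : Fin 3)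
    {x : E3} (hx : x ≠ 0) (hxη : ‖x‖ < η.rIn) :
    kupradzeMatrix lam μ k x i j =
      truncKernel η μ (k / √(lam + 2 * μ)) (k / √μ) i j x := by
  have hη : ∀ y : E3, ‖y‖ < η.rIn → (η ‖y‖ : ℂ) = 1 := fun y hy => by
    rw [η.one_of_mem_closedBall, Complex.ofReal_one]
    simpa using hy.le
  have hev : (fun y : E3 => sphericalWave (k / √μ) y - sphericalWave (k / √(lam + 2 * μ)) y)
      =ᶠ[nhds x] fun y => truncQuot η (k / √(lam + 2 * μ)) (k / √μ) √(‖y‖ ^ 2 + 0) := by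
    have h1 : ∀ᶠ y : E3 in nhds x, ‖y‖ < η.rIn :=
      continuous_norm.continuousAt.eventually (gt_mem_nhds hxη)
    filter_upwards [h1, isOpen_ne.mem_nhds hx] with y hy hy0
    have hn : (‖y‖ : ℂ) ≠ 0 := by exact_mod_cast norm_ne_zero_iff.mpr hy0
    rw [add_zero, Real.sqrt_sq (norm_nonneg y), truncQuot, hη y hy, one_mul, sphericalWave,
      sphericalWave, ← sub_div, ← mul_waveQuot, mul_div_cancel_left₀ _ hn]
  have hev2 : partialDeriv j
      (fun y : E3 => sphericalWave (k / √μ) y - sphericalWave (k / √(lam + 2 * μ)) y)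
      =ᶠ[nhds x] partialDeriv j
        fun y => truncQuot η (k / √(lam + 2 * μ)) (k / √μ) √(‖y‖ ^ 2 + 0) :=
    hev.fderiv.fun_comp fun L => L (EuclideanSpace.single j (1 : ℝ))
  have hH : partialDeriv i (partialDeriv j
      (fun y : E3 => sphericalWave (k / √μ) y - sphericalWave (k / √(lam + 2 * μ)) y)) x =
      radialHessian (truncQuot η (k / √(lam + 2 * μ)) (k / √μ)) 0 i j x := by
    rw [partialDeriv, hev2.fderiv_eq]
    exact partialDeriv_partialDeriv_radial ((contDiff_truncQuot η _ _).of_le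
      (by exact WithTop.coe_le_coe.mpr le_top)) (by simpa [sq_pos_iff] using hx) i j
  simp only [kupradzeMatrix, Matrix.of_apply, hH]
  simp only [truncKernel, truncWave, hη x hxη, one_mul, sphericalWave]

theorem exists_norm_truncKernel_le (η : ContDiffBump (0 : ℝ)) (μ κ₁ κ₂ : ℝ) (i j : Fin 3) :
    ∃ C : ℝ, ∀ x, x ≠ 0 → ‖truncKernel η μ κ₁ κ₂ i j x‖ ≤ C * coulomb (η.rOut + 1) x := by
  obtain ⟨B, hB0, hB⟩ := exists_bound_iteratedDeriv (contDiff_truncQuot η κ₁ κ₂)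
    (hasCompactSupport_truncQuot η κ₁ κ₂) 2
  have b1 : ∀ r, ‖deriv (truncQuot η κ₁ κ₂) r‖ ≤ B := fun r => by
    simpa [iteratedDeriv_one] using hB 1 (by norm_num) r
  have b2 : ∀ r, ‖deriv (deriv (truncQuot η κ₁ κ₂)) r‖ ≤ B := fun r => by
    simpa [iteratedDeriv_succ, iteratedDeriv_zero] using hB 2 le_rfl r
  refine ⟨‖(1 / (4 * Real.pi * μ : ℂ))‖ *
    (1 + ‖(1 / (κ₂ : ℂ) ^ 2)‖ * (B * (η.rOut + 1 + 2))), fun x hx => ?_⟩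
  have hH := norm_radialHessian_le_coulomb b1 b2 (lt_add_one η.rOut) (fun r hr =>
    truncQuot_eq_zero η κ₁ κ₂ (hr.trans (le_abs_self r))) le_rfl i j hx
  have hc0 : 0 ≤ coulomb (η.rOut + 1) x :=
    Set.indicator_nonneg (fun _ _ => inv_nonneg.mpr (norm_nonneg _)) x
  have hW : ‖truncWave η κ₂ ‖x‖ / (‖x‖ : ℂ)‖ ≤ coulomb (η.rOut + 1) x := by
    by_cases hA : x ∈ Metric.ball (0 : E3) (η.rOut + 1)
    · rw [coulomb, Set.indicator_of_mem hA, truncWave,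
        show Complex.I * κ₂ * (‖x‖ : ℂ) = ((κ₂ * ‖x‖ : ℝ) : ℂ) * Complex.I by push_cast; ring,
        norm_div, norm_mul, Complex.norm_exp_ofReal_mul_I, mul_one, Complex.norm_real,
        Complex.norm_real, norm_norm, Real.norm_eq_abs, abs_of_nonneg η.nonneg, div_eq_mul_inv]
      exact mul_le_of_le_one_left (inv_nonneg.mpr (norm_nonneg _)) η.le_one
    · have hx' : η.rOut + 1 ≤ ‖x‖ := by simpa using hA
      rw [truncWave_eq_zero η κ₂ (by linarith), zero_div, norm_zero]
      exact hc0
  have hδ : ‖(if i = j then truncWave η κ₂ ‖x‖ / ‖x‖ else 0 : ℂ)‖ ≤ coulomb (η.rOut + 1) x := by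
    split_ifs
    · exact hW
    · rwa [norm_zero]
  rw [truncKernel, norm_mul, mul_assoc ‖_‖]
  have hc : 0 ≤ ‖(1 / (4 * Real.pi * μ : ℂ))‖ := norm_nonneg _
  refine mul_le_mul_of_nonneg_left ?_ hc
  refine (norm_add_le _ _).trans ?_
  rw [norm_mul (1 / (κ₂ : ℂ) ^ 2), add_mul, one_mul, mul_assoc]
  exact add_le_add hδ (mul_le_mul_of_nonneg_left hH (norm_nonneg _))

theorem measurable_truncKernel (η : ContDiffBump (0 : ℝ)) (μ κ₁ κ₂ : ℝ) (i j : Fin 3) :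
    Measurable (truncKernel η μ κ₁ κ₂ i j) := by
  have h1 : Measurable (radialHessian (truncQuot η κ₁ κ₂) 0 i j) :=
    measurable_radialHessian ((contDiff_truncQuot η κ₁ κ₂).of_le
      (by exact WithTop.coe_le_coe.mpr le_top)) 0 i j
  have h2 : Measurable (truncWave η κ₂) := (contDiff_truncWave η κ₂).continuous.measurable
  unfold truncKernel
  split_ifs <;> fun_prop

theorem integrable_truncKernel (η : ContDiffBump (0 : ℝ)) (μ κ₁ κ₂ : ℝ) (i j : Fin 3) :
    Integrable (truncKernel η μ κ₁ κ₂ i j) := by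
  obtain ⟨C, hC⟩ := exists_norm_truncKernel_le η μ κ₁ κ₂ i j
  refine ((integrable_coulomb (η.rOut + 1)).const_mul C).mono'
    (measurable_truncKernel η μ κ₁ κ₂ i j).aestronglyMeasurable ?_
  filter_upwards [Measure.ae_ne volume (0 : E3)] with x hx using hC x hx

theorem memLp_truncKernel (η : ContDiffBump (0 : ℝ)) (μ κ₁ κ₂ : ℝ) (i j : Fin 3) :
    MemLp (truncKernel η μ κ₁ κ₂ i j) 2 := by
  obtain ⟨C, hC⟩ := exists_norm_truncKernel_le η μ κ₁ κ₂ i j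
  refine ((memLp_coulomb (η.rOut + 1)).const_mul C).mono'
    (measurable_truncKernel η μ κ₁ κ₂ i j).aestronglyMeasurable ?_
  filter_upwards [Measure.ae_ne volume (0 : E3)] with x hx using hC x hx

theorem integrable_radialHessian_truncQuot (η : ContDiffBump (0 : ℝ)) (κ₁ κ₂ : ℝ) (i j : Fin 3) :
    Integrable (radialHessian (truncQuot η κ₁ κ₂) 0 i j) := by
  obtain ⟨B, hB0, hB⟩ := exists_bound_iteratedDeriv (contDiff_truncQuot η κ₁ κ₂)
    (hasCompactSupport_truncQuot η κ₁ κ₂) 2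
  have b1 : ∀ r, ‖deriv (truncQuot η κ₁ κ₂) r‖ ≤ B := fun r => by
    simpa [iteratedDeriv_one] using hB 1 (by norm_num) r
  have b2 : ∀ r, ‖deriv (deriv (truncQuot η κ₁ κ₂)) r‖ ≤ B := fun r => by
    simpa [iteratedDeriv_succ, iteratedDeriv_zero] using hB 2 le_rfl r
  refine ((integrable_coulomb (η.rOut + 1)).const_mul (B * (η.rOut + 1 + 2))).mono'
    (measurable_radialHessian ((contDiff_truncQuot η κ₁ κ₂).of_le
      (by exact WithTop.coe_le_coe.mpr le_top)) 0 i j).aestronglyMeasurable ?_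
  filter_upwards [Measure.ae_ne volume (0 : E3)] with x hx
  exact norm_radialHessian_le_coulomb b1 b2 (lt_add_one η.rOut) (fun r hr =>
    truncQuot_eq_zero η κ₁ κ₂ (hr.trans (le_abs_self r))) le_rfl i j hx

theorem fourier_truncKernel (η : ContDiffBump (0 : ℝ)) (μ κ₁ κ₂ : ℝ) (i j : Fin 3) (ξ : E3) :
    𝓕 (truncKernel η μ κ₁ κ₂ i j) ξ = 1 / (4 * Real.pi * μ : ℂ) *
      ((if i = j then 𝓕 (fun x : E3 => truncWave η κ₂ ‖x‖ / ‖x‖) ξ else 0) +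
        1 / (κ₂ : ℂ) ^ 2 * ((2 * Real.pi * Complex.I) ^ 2 * ξ i * ξ j *
          𝓕 (fun x : E3 => (truncWave η κ₂ ‖x‖ - truncWave η κ₁ ‖x‖) / ‖x‖) ξ)) := by
  obtain ⟨B, hB0, hB⟩ := exists_bound_iteratedDeriv (contDiff_truncQuot η κ₁ κ₂)
    (hasCompactSupport_truncQuot η κ₁ κ₂) 2
  have hae : (fun x : E3 => (truncWave η κ₂ ‖x‖ - truncWave η κ₁ ‖x‖) / ‖x‖) =ᵐ[volume]
      fun x => truncQuot η κ₁ κ₂ ‖x‖ := by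
    filter_upwards [Measure.ae_ne volume (0 : E3)] with x hx
    have hn : (‖x‖ : ℂ) ≠ 0 := by exact_mod_cast norm_ne_zero_iff.mpr hx
    rw [← mul_truncQuot, mul_div_cancel_left₀ _ hn]
  rw [Real.fourier_congr_ae hae, ← fourier_radialHessian (contDiff_truncQuot η κ₁ κ₂) hB
    (lt_add_one η.rOut) (fun r hr => truncQuot_eq_zero η κ₁ κ₂ (hr.trans (le_abs_self r))) i j ξ]
  have hW : Integrable fun x : E3 => truncWave η κ₂ ‖x‖ / ‖x‖ :=
    integrable_radial_div (contDiff_truncWave η κ₂).continuous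
      fun r hr => truncWave_eq_zero η κ₂ hr
  have hH := integrable_radialHessian_truncQuot η κ₁ κ₂ i j
  set e : E3 → ℂ := fun x => Complex.exp ((-2 * Real.pi * inner ℝ x ξ : ℝ) * Complex.I)
  have he : ∀ {f : E3 → ℂ}, Integrable f → Integrable fun x => e x * f x := fun hf => by
    refine hf.bdd_mul (c := 1) (Continuous.aestronglyMeasurable (by fun_prop))
      (Filter.Eventually.of_forall fun y => ?_)
    rw [Complex.norm_exp_ofReal_mul_I]
  simp only [Real.fourier_eq', smul_eq_mul]
  change ∫ x, e x * truncKernel η μ κ₁ κ₂ i j x = 1 / (4 * Real.pi * μ : ℂ) *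
    ((if i = j then ∫ x : E3, e x * (truncWave η κ₂ ‖x‖ / ‖x‖) else 0) +
      1 / (κ₂ : ℂ) ^ 2 * ∫ x, e x * radialHessian (truncQuot η κ₁ κ₂) 0 i j x)
  have hδ : Integrable fun x => e x * (if i = j then truncWave η κ₂ ‖x‖ / ‖x‖ else 0) := by
    split_ifs
    · exact he hW
    · simp
  have hδ' : ∫ x, e x * (if i = j then truncWave η κ₂ ‖x‖ / ‖x‖ else 0) =
      if i = j then ∫ x : E3, e x * (truncWave η κ₂ ‖x‖ / ‖x‖) else 0 := by
    split_ifs <;> simp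
  rw [← hδ', ← integral_const_mul (1 / (κ₂ : ℂ) ^ 2), ← integral_add hδ ((he hH).const_mul _),
    ← integral_const_mul]
  congr 1
  funext x
  rw [truncKernel]
  ring

/-- The multiplier bound behind the Sobolev estimates, with explicit dependence on both wave
numbers. -/
theorem norm_fourier_truncKernel_le (η : ContDiffBump (0 : ℝ)) {B : ℝ}
    (hB : ∀ n ≤ 3, ∀ r, ‖iteratedDeriv n (fun r => (η r : ℂ)) r‖ ≤ B) {μ κ₁ κ₂ : ℝ} (hμ : 0 < μ)
    (hκ₁ : 0 < κ₁) (hκ₂ : 0 < κ₂) (i j : Fin 3) {ξ : E3} (hξ : ξ ≠ 0) {m : ℕ} (hm : m ≤ 2) :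
    κ₂ * ((2 * Real.pi * ‖ξ‖) ^ m * ‖𝓕 (truncKernel η μ κ₁ κ₂ i j) ξ‖) ≤
      1 / μ * ((2 + η.rOut) ^ 2 * B * (1 + κ₁ + κ₂) ^ m * (1 + 2 * (1 + κ₁ + κ₂) / κ₂)) := by
  set s : ℝ := 2 * Real.pi * ‖ξ‖ with hs
  have hs0 : 0 < s := by
    have := norm_pos_iff.mpr hξ
    positivity
  set A : ℝ := η.rOut + 1 with hA
  have hA0 : 0 ≤ A := by linarith [η.rOut_pos]
  have hB0 : 0 ≤ B := (norm_nonneg _).trans (hB 0 (by norm_num) 0)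
  set M : ℝ := 1 + κ₁ + κ₂ with hM
  have hM1 : 1 ≤ M := by linarith
  set W : ℂ := 𝓕 (fun x : E3 => truncWave η κ₂ ‖x‖ / ‖x‖) ξ
  set D : ℂ := 𝓕 (fun x : E3 => (truncWave η κ₂ ‖x‖ - truncWave η κ₁ ‖x‖) / ‖x‖) ξ
  have hη : η.rOut ≤ A := by linarith
  have h4π : ‖(4 * Real.pi : ℂ)‖ = 4 * Real.pi := by
    simp [abs_of_pos Real.pi_pos]
  have hW : κ₂ * (s ^ m * ‖W‖) ≤ 4 * Real.pi * ((1 + A) ^ 2 * B * M ^ m) := by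
    have e := fourier_radial (contDiff_truncWave η κ₂).continuous hA0
      (fun r hr => truncWave_eq_zero η κ₂ (hη.trans hr)) ξ
    have e' := congrArg norm e
    rw [norm_mul, norm_mul, Complex.norm_real, Real.norm_eq_abs, ← hs, abs_of_pos hs0, h4π] at e'
    have h := pow_mul_norm_sine_truncWave_le η (fun n hn => hB n (by omega)) hA0 hη hκ₂.le hs0.le hm
    have hmono : (1 + κ₂) ^ m ≤ M ^ m := pow_le_pow_left₀ (by linarith) (by linarith) m
    have h' : κ₂ * (s ^ m * ‖W‖) * s ≤ 4 * Real.pi * ((1 + A) ^ 2 * B * M ^ m) * s := by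
      calc κ₂ * (s ^ m * ‖W‖) * s = κ₂ * s ^ m * (s * ‖W‖) := by ring
        _ = 4 * Real.pi * (κ₂ * (s ^ m *
            ‖∫ r in 0..A, (Real.sin (s * r) : ℂ) * truncWave η κ₂ r‖)) := by rw [e']; ring
        _ ≤ 4 * Real.pi * ((1 + A) ^ 2 * B * (1 + κ₂) ^ m * s) := by gcongr
        _ ≤ 4 * Real.pi * ((1 + A) ^ 2 * B * M ^ m * s) := by gcongr
        _ = _ := by ring
    exact le_of_mul_le_mul_right h' hs0
  have hD : s ^ (m + 2) * ‖D‖ ≤ 4 * Real.pi * ((1 + A) * (2 * B) * M ^ (m + 1)) := by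
    have hc2 := contDiff_truncWave η κ₂
    have hc1 := contDiff_truncWave η κ₁
    have hc := hc2.sub hc1
    have e := fourier_radial (h := fun r => truncWave η κ₂ r - truncWave η κ₁ r) hc.continuous hA0
      (fun r hr => by rw [truncWave_eq_zero η κ₂ (hη.trans hr),
        truncWave_eq_zero η κ₁ (hη.trans hr), sub_zero]) ξ
    have e' := congrArg norm e
    rw [norm_mul, norm_mul, Complex.norm_real, Real.norm_eq_abs, ← hs, abs_of_pos hs0, h4π] at e'
    have hbd : ∀ n ≤ 3, ∀ r,
        ‖iteratedDeriv n (fun r => truncWave η κ₂ r - truncWave η κ₁ r) r‖ ≤ 2 * B * M ^ n := by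
      intro n hn r
      have hsub : iteratedDeriv n (fun r => truncWave η κ₂ r - truncWave η κ₁ r) r =
          iteratedDeriv n (truncWave η κ₂) r - iteratedDeriv n (truncWave η κ₁) r :=
        iteratedDeriv_fun_sub (hc2.contDiffAt.of_le (by exact WithTop.coe_le_coe.mpr le_top))
          (hc1.contDiffAt.of_le (by exact WithTop.coe_le_coe.mpr le_top))
      rw [hsub]
      have b2 := norm_iteratedDeriv_truncWave_le η hB hκ₂.le hn r
      have b1 := norm_iteratedDeriv_truncWave_le η hB hκ₁.le hn r
      have m2 : B * (1 + κ₂) ^ n ≤ B * M ^ n :=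
        mul_le_mul_of_nonneg_left (pow_le_pow_left₀ (by linarith) (by linarith) n) hB0
      have m1 : B * (1 + κ₁) ^ n ≤ B * M ^ n :=
        mul_le_mul_of_nonneg_left (pow_le_pow_left₀ (by linarith) (by linarith) n) hB0
      refine (norm_sub_le _ _).trans ?_
      linarith
    have hev : ∀ᶠ r in nhds A, truncWave η κ₂ r - truncWave η κ₁ r = 0 := by
      filter_upwards [lt_mem_nhds (lt_add_one η.rOut)] with r hr
      rw [truncWave_eq_zero η κ₂ hr.le, truncWave_eq_zero η κ₁ hr.le, sub_zero]
    have h := pow_mul_norm_sine_integral_le (hc.of_le (by exact WithTop.coe_le_coe.mpr le_top))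
      hA0 hev (by simp [truncWave]) hM1 hbd hs0.le hm
    calc s ^ (m + 2) * ‖D‖ = s ^ (m + 1) * (s * ‖D‖) := by ring
      _ = 4 * Real.pi * (s ^ (m + 1) * ‖∫ r in 0..A, (Real.sin (s * r) : ℂ) *
          (truncWave η κ₂ r - truncWave η κ₁ r)‖) := by rw [e']; ring
      _ ≤ _ := by gcongr
  have hij : ‖((2 * Real.pi * Complex.I) ^ 2 * ξ i * ξ j : ℂ)‖ ≤ s ^ 2 := by
    have hi := PiLp.norm_apply_le ξ i
    have hj := PiLp.norm_apply_le ξ j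
    have e : ‖((2 * Real.pi * Complex.I) ^ 2 * ξ i * ξ j : ℂ)‖ =
        (2 * Real.pi) ^ 2 * (‖ξ i‖ * ‖ξ j‖) := by
      simp [abs_of_pos Real.pi_pos]
      ring
    rw [e, hs, mul_pow (2 * Real.pi), pow_two ‖ξ‖]
    gcongr
  have hK : ‖𝓕 (truncKernel η μ κ₁ κ₂ i j) ξ‖ ≤
      1 / (4 * Real.pi * μ) * (‖W‖ + 1 / κ₂ ^ 2 * (s ^ 2 * ‖D‖)) := by
    have n1 : ‖(1 / (4 * Real.pi * μ : ℂ))‖ = 1 / (4 * Real.pi * μ) := by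
      simp [abs_of_pos Real.pi_pos, abs_of_pos hμ]
    have n2 : ‖(1 / (κ₂ : ℂ) ^ 2)‖ = 1 / κ₂ ^ 2 := by simp
    rw [fourier_truncKernel, norm_mul, n1]
    have hπμ : 0 ≤ 1 / (4 * Real.pi * μ) := by positivity
    refine mul_le_mul_of_nonneg_left ((norm_add_le _ _).trans (add_le_add ?_ ?_)) hπμ
    · split_ifs
      · exact le_rfl
      · simp
    · rw [norm_mul, n2, norm_mul]
      gcongr
  calc κ₂ * (s ^ m * ‖𝓕 (truncKernel η μ κ₁ κ₂ i j) ξ‖)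
      ≤ κ₂ * (s ^ m * (1 / (4 * Real.pi * μ) * (‖W‖ + 1 / κ₂ ^ 2 * (s ^ 2 * ‖D‖)))) := by gcongr
    _ = 1 / (4 * Real.pi * μ) *
        (κ₂ * (s ^ m * ‖W‖) + 1 / κ₂ * (s ^ (m + 2) * ‖D‖)) := by
      field_simp
      ring
    _ ≤ 1 / (4 * Real.pi * μ) * (4 * Real.pi * ((1 + A) ^ 2 * B * M ^ m) +
        1 / κ₂ * (4 * Real.pi * ((1 + A) ^ 2 * (2 * B) * M ^ (m + 1)))) := by
      have hAA : 1 + A ≤ (1 + A) ^ 2 := by nlinarith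
      have hD' : s ^ (m + 2) * ‖D‖ ≤ 4 * Real.pi * ((1 + A) ^ 2 * (2 * B) * M ^ (m + 1)) :=
        hD.trans (by gcongr)
      gcongr
    _ = 1 / μ * ((2 + η.rOut) ^ 2 * B * M ^ m * (1 + 2 * M / κ₂)) := by
      rw [show 2 + η.rOut = 1 + A by rw [hA]; ring]
      field_simp
      ring

/-- The multiplier bound for the two elastic wave numbers: the truncated Kupradze matrix has Fourier
transform `O(k^{m-1} |ξ|^{-m})` for `m = 0, 1, 2`, uniformly in `k ≥ k₀`. -/
theorem exists_fourier_truncKernel_bound (η : ContDiffBump (0 : ℝ)) {lam μ k₀ : ℝ} (hμ : 0 < μ)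
    (hlam : 0 < lam + 2 * μ) (hk₀ : 0 < k₀) :
    ∃ C : ℝ, 0 < C ∧ ∀ k, k₀ ≤ k → ∀ i j : Fin 3, ∀ m ≤ 2, ∀ ξ : E3, ξ ≠ 0 →
      (2 * Real.pi * ‖ξ‖) ^ m *
        ‖𝓕 (truncKernel η μ (k / √(lam + 2 * μ)) (k / √μ) i j) ξ‖ ≤ C * k ^ m / k := by
  obtain ⟨B, hB0, hB⟩ := exists_bound_iteratedDeriv_bump η 3
  have hsμ : 0 < √μ := Real.sqrt_pos.mpr hμ
  have hsl : 0 < √(lam + 2 * μ) := Real.sqrt_pos.mpr hlam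
  set L : ℝ := 1 / k₀ + 1 / √(lam + 2 * μ) + 1 / √μ with hL
  have hL0 : 0 < L := by positivity
  have hη := η.rOut_pos
  refine ⟨√μ * (1 / μ * ((2 + η.rOut) ^ 2 * B * (1 + L) ^ 2 * (1 + 2 * (L * √μ)))),
    by positivity, fun k hk i j m hm ξ hξ => ?_⟩
  have hk0 : 0 < k := hk₀.trans_le hk
  -- `L` absorbs the lower order term: `1 + κ₁ + κ₂ ≤ L k` because of `k₀ ≤ k`.
  have hκ₁ : 0 < k / √(lam + 2 * μ) := by positivity
  have hκ₂ : 0 < k / √μ := by positivity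
  have h := norm_fourier_truncKernel_le η hB hμ hκ₁ hκ₂ i j hξ hm
  have hML : 1 + k / √(lam + 2 * μ) + k / √μ ≤ L * k := by
    have h1 : 1 ≤ 1 / k₀ * k := by rw [one_div, inv_mul_eq_div, le_div_iff₀ hk₀, one_mul]; exact hk
    have : L * k = 1 / k₀ * k + k / √(lam + 2 * μ) + k / √μ := by rw [hL]; ring
    linarith
  have hMm : (1 + k / √(lam + 2 * μ) + k / √μ) ^ m ≤ (1 + L) ^ 2 * k ^ m := by
    refine (pow_le_pow_left₀ (by positivity) hML m).trans ?_
    rw [mul_pow]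
    gcongr
    exact (pow_le_pow_left₀ hL0.le (by linarith) m).trans
      (pow_le_pow_right₀ (by linarith) hm)
  have hMκ : 2 * (1 + k / √(lam + 2 * μ) + k / √μ) / (k / √μ) ≤ 2 * (L * √μ) := by
    rw [div_le_iff₀ hκ₂]
    calc _ ≤ 2 * (L * k) := by gcongr
      _ = _ := by field_simp
  rw [le_div_iff₀ hk0]
  calc (2 * Real.pi * ‖ξ‖) ^ m *
        ‖𝓕 (truncKernel η μ (k / √(lam + 2 * μ)) (k / √μ) i j) ξ‖ * k
      = √μ * (k / √μ * ((2 * Real.pi * ‖ξ‖) ^ m *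
        ‖𝓕 (truncKernel η μ (k / √(lam + 2 * μ)) (k / √μ) i j) ξ‖)) := by field_simp
    _ ≤ √μ * (1 / μ * ((2 + η.rOut) ^ 2 * B * ((1 + L) ^ 2 * k ^ m) * (1 + 2 * (L * √μ)))) := by
      refine mul_le_mul_of_nonneg_left (h.trans ?_) hsμ.le
      gcongr
    _ = _ := by ring

/-! ### Sobolev estimates for the Newton potential -/

theorem tsupport_partialDeriv_subset (φ : E3 → ℝ) (i : Fin 3) :
    tsupport (partialDeriv i φ) ⊆ tsupport φ :=
  tsupport_fderiv_apply_subset ℝ _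

theorem tsupport_multiDeriv_subset (φ : E3 → ℝ) (α : Fin 3 → ℕ) :
    tsupport (multiDeriv α φ) ⊆ tsupport φ := by
  have hit : ∀ (i : Fin 3) (n : ℕ) (ψ : E3 → ℝ),
      tsupport ((partialDeriv i)^[n] ψ) ⊆ tsupport ψ := fun i n ψ => by
    induction n with
    | zero => exact subset_rfl
    | succ n ih =>
      rw [Function.iterate_succ_apply']
      exact (tsupport_partialDeriv_subset _ i).trans ih
  exact (hit 0 _ _).trans ((hit 1 _ _).trans (hit 2 _ _))

theorem contDiff_multiDeriv {φ : E3 → ℝ} (hφ : ContDiff ℝ ∞ φ) (α : Fin 3 → ℕ) :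
    ContDiff ℝ ∞ (multiDeriv α φ) :=
  contDiff_iterate_partialDeriv (contDiff_iterate_partialDeriv
    (contDiff_iterate_partialDeriv hφ 2 _) 1 _) 0 _

/-- A test function supported in `Ω` may be integrated over the whole space, coordinatewise. -/
theorem setIntegral_smul_apply {Ω : Set E3} {φ : E3 → ℝ} (hφ : Continuous φ)
    (hφc : HasCompactSupport φ) (hφΩ : tsupport φ ⊆ Ω) {u : E3 → C3} {w : Fin 3 → Fin 3 → E3 → ℂ}
    (hw : ∀ i j, LocallyIntegrable (w i j)) (huw : ∀ x ∈ Ω, ∀ i, u x i = ∑ j, w i j x)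
    (i : Fin 3) :
    (∫ x in Ω, φ x • u x) i = ∑ j, ∫ x, (φ x : ℂ) * w i j x := by
  have hzero : ∀ x, x ∉ Ω → φ x = 0 := fun x hx =>
    image_eq_zero_of_notMem_tsupport fun h => hx (hφΩ h)
  rw [setIntegral_eq_integral_of_forall_compl_eq_zero fun x hx => by rw [hzero x hx, zero_smul]]
  have hcoord : ∀ x i, (φ x • u x) i = ∑ j, (φ x : ℂ) * w i j x := fun x i => by
    by_cases hx : x ∈ Ω
    · rw [PiLp.smul_apply, huw x hx, Complex.real_smul, Finset.mul_sum]
    · simp [hzero x hx]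
  have hint : ∀ i j, Integrable fun x => (φ x : ℂ) * w i j x := fun i j => by
    simpa only [Complex.real_smul] using
      (hw i j).integrable_smul_left_of_hasCompactSupport hφ hφc
  have hint' : ∀ i, Integrable fun x => (φ x • u x) i := fun i => by
    simp only [hcoord]
    exact integrable_finsetSum _ fun j _ => hint i j
  rw [eval_integral_piLp hint']
  simp only [hcoord]
  exact integral_finsetSum _ fun j _ => hint i j

theorem eLpNorm_le_sum_coord {v : E3 → C3} {ν : Measure E3}
    (hv : ∀ i, AEStronglyMeasurable (fun x => v x i) ν) :
    eLpNorm v 2 ν ≤ ∑ i, eLpNorm (fun x => v x i) 2 ν := by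
  have e : v = ∑ i, fun x => EuclideanSpace.single i (v x i) := by
    funext x
    ext l
    simp [Finset.sum_apply, Pi.single_apply]
  calc eLpNorm v 2 ν = eLpNorm (∑ i, fun x => (EuclideanSpace.single i (v x i) : C3)) 2 ν := by
        rw [← e]
    _ ≤ ∑ i, eLpNorm (fun x => (EuclideanSpace.single i (v x i) : C3)) 2 ν := by
        refine eLpNorm_sum_le (fun i _ => ?_) (by norm_num)
        exact ((PiLp.continuous_toLp 2 _).comp (continuous_single i)).comp_aestronglyMeasurable
          (hv i)
    _ = ∑ i, eLpNorm (fun x => v x i) 2 ν := by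
        refine Finset.sum_congr rfl fun i _ => eLpNorm_congr_norm_ae ?_
        exact Filter.Eventually.of_forall fun x => by simp

/-- If, on `Ω`, the field `u` is the convolution of a square integrable `f` with a matrix of
integrable kernels whose Fourier transforms are `O(|ξ|^{-|α|})`, then it has a weak derivative
`∂^α u` bounded in `L²` by `f`. The factor `9` counts the matrix entries. -/
theorem exists_hasWeakDeriv_of_convolution {Ω : Set E3} (hΩ : IsOpen Ω)
    {K : Fin 3 → Fin 3 → E3 → ℂ} (hK : ∀ i j, Integrable (K i j)) {g : Fin 3 → E3 → ℂ}
    (hg : ∀ j, Integrable (g j)) (hg2 : ∀ j, MemLp (g j) 2) {F : ℝ≥0∞}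
    (hF : ∀ j, eLpNorm (g j) 2 volume ≤ F) {u : E3 → C3}
    (hu : ∀ x ∈ Ω, ∀ i, u x i = ∑ j, (K i j ⋆[ContinuousLinearMap.mul ℂ ℂ] g j) x)
    (α : Fin 3 → ℕ) {M : ℝ}
    (hM : ∀ i j, ∀ᵐ ξ, (2 * Real.pi * ‖ξ‖) ^ (∑ l, α l) * ‖𝓕 (K i j) ξ‖ ≤ M) :
    ∃ v : E3 → C3, HasWeakDeriv Ω α u v ∧ MemLp v 2 (volume.restrict Ω) ∧
      eLpNorm v 2 (volume.restrict Ω) ≤ 9 * (ENNReal.ofReal M * F) := by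
  choose w hw2 hwle hwφ using fun i j =>
    exists_weakDeriv_convolution (hK i j) (hg j) (hg2 j) α (hM i j)
  have hconv : ∀ i j, Integrable (K i j ⋆[ContinuousLinearMap.mul ℂ ℂ] g j) := fun i j =>
    (hK i j).integrable_convolution _ (hg j)
  set v : E3 → C3 := fun x => WithLp.toLp 2 fun i => ∑ j, w i j x
  have hv : ∀ x i, v x i = ∑ j, w i j x := fun x i => rfl
  have hvi : ∀ i, MemLp (fun x => v x i) 2 := fun i =>
    memLp_finsetSum (f := w i) Finset.univ fun j _ => hw2 i j
  have hv2 : MemLp v 2 := memLp_piLp_iff.mpr hvi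
  have hu1 : IntegrableOn u Ω := by
    refine integrable_piLp_iff.mpr fun i => ?_
    have h1 : Integrable fun x => ∑ j, (K i j ⋆[ContinuousLinearMap.mul ℂ ℂ] g j) x :=
      integrable_finsetSum _ fun j _ => hconv i j
    exact h1.integrableOn.congr_fun (fun x hx => (hu x hx i).symm) hΩ.measurableSet
  refine ⟨v, ⟨hu1.locallyIntegrableOn,
    (hv2.locallyIntegrable (by norm_num)).locallyIntegrableOn Ω, fun φ h1 h2 h3 => ?_⟩,
    hv2.restrict Ω, ?_⟩
  · ext i
    have hs := tsupport_multiDeriv_subset φ α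
    rw [setIntegral_smul_apply (contDiff_multiDeriv h1 α).continuous
      (h2.of_isClosed_subset (isClosed_tsupport _) hs) (hs.trans h3)
      (fun i j => (hconv i j).locallyIntegrable) hu, PiLp.smul_apply,
      setIntegral_smul_apply h1.continuous h2 h3
      (fun i j => (hw2 i j).locallyIntegrable (by norm_num)) (fun x _ => hv x), Complex.real_smul,
      Finset.mul_sum]
    refine Finset.sum_congr rfl fun j _ => ?_
    rw [hwφ i j φ h1 h2]
    simp
  · calc eLpNorm v 2 (volume.restrict Ω) ≤ eLpNorm v 2 volume := eLpNorm_restrict_le _ _ _ _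
      _ ≤ ∑ i, eLpNorm (fun x => v x i) 2 volume := eLpNorm_le_sum_coord fun i => (hvi i).1
      _ ≤ ∑ i : Fin 3, ∑ j : Fin 3, eLpNorm (w i j) 2 volume := by
        refine Finset.sum_le_sum fun i _ => ?_
        have e : (fun x => v x i) = ∑ j, w i j := by
          funext x
          rw [hv, Finset.sum_apply]
        rw [e]
        exact eLpNorm_sum_le (fun j _ => (hw2 i j).1) (by norm_num)
      _ ≤ ∑ _i : Fin 3, ∑ _j : Fin 3, ENNReal.ofReal M * F := by
        refine Finset.sum_le_sum fun i _ => Finset.sum_le_sum fun j _ => ?_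
        exact (hwle i j).trans (mul_le_mul_right (hF j) _)
      _ = 9 * (ENNReal.ofReal M * F) := by
        simp only [Finset.sum_const, Finset.card_univ, Fintype.card_fin, nsmul_eq_mul]
        rw [← mul_assoc]
        norm_num

/-- There are ten multi-indices of order at most two in three variables. -/
theorem sobolevNorm_le {m : ℕ} (hm : m ≤ 2) {Ω : Set E3} {u : E3 → C3} {X : ℝ≥0∞}
    (h : ∀ α : Fin 3 → ℕ, ∑ i, α i ≤ m → weakDerivNorm Ω α u ≤ X) :
    sobolevNorm m Ω u ≤ 10 * X := by
  have hcard : (∑ n ∈ Finset.range (m + 1), (Finset.Nat.antidiagonalTuple 3 n).card) ≤ 10 := by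
    interval_cases m <;> decide
  have hsum : ∑ n ∈ Finset.range (m + 1), ∑ α ∈ Finset.Nat.antidiagonalTuple 3 n,
      weakDerivNorm Ω α u ^ 2 ≤ (10 * X) ^ 2 := by
    calc _ ≤ ∑ n ∈ Finset.range (m + 1), ∑ _α ∈ Finset.Nat.antidiagonalTuple 3 n, X ^ 2 := by
          refine Finset.sum_le_sum fun n hn => Finset.sum_le_sum fun α hα => ?_
          have hα' : ∑ i, α i = n := Finset.Nat.mem_antidiagonalTuple.mp hα
          have hn' : n ≤ m := Finset.mem_range_succ_iff.mp hn
          gcongr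
          exact h α (hα'.trans_le hn')
      _ = ((∑ n ∈ Finset.range (m + 1), (Finset.Nat.antidiagonalTuple 3 n).card : ℕ) : ℝ≥0∞) *
          X ^ 2 := by
          simp only [Finset.sum_const, nsmul_eq_mul, Nat.cast_sum, Finset.sum_mul]
      _ ≤ 10 * X ^ 2 := by
          gcongr
          exact_mod_cast hcard
      _ ≤ (10 * X) ^ 2 := by
          rw [mul_pow]
          gcongr
          norm_num
  calc sobolevNorm m Ω u ≤ ((10 * X) ^ 2) ^ (1 / 2 : ℝ) := by
        rw [sobolevNorm]
        gcongr
    _ = 10 * X := by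
        rw [← ENNReal.rpow_natCast, ← ENNReal.rpow_mul]
        norm_num

theorem weakDerivNorm_le {Ω : Set E3} {α : Fin 3 → ℕ} {u v : E3 → C3} {X : ℝ≥0∞}
    (hv : HasWeakDeriv Ω α u v) (hX : eLpNorm v 2 (volume.restrict Ω) ≤ X) :
    weakDerivNorm Ω α u ≤ X :=
  (iInf₂_le v hv).trans hX

theorem hasWeakDeriv_zero {Ω : Set E3} {u : E3 → C3} (hu : LocallyIntegrableOn u Ω) :
    HasWeakDeriv Ω 0 u u :=
  ⟨hu, hu, fun φ _ _ _ => by simp [multiDeriv]⟩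

/-- Extension by zero of a coordinate of a square integrable field on a bounded open set. -/
theorem memLp_indicator_coord {Ω : Set E3} (hΩ : IsOpen Ω) {f : E3 → C3}
    (hf : MemLp f 2 (volume.restrict Ω)) (j : Fin 3) :
    MemLp (Ω.indicator fun y => f y j) 2 ∧
      eLpNorm (Ω.indicator fun y => f y j) 2 volume ≤ eLpNorm f 2 (volume.restrict Ω) := by
  refine ⟨(memLp_indicator_iff_restrict hΩ.measurableSet).mpr (memLp_piLp_iff.mp hf j), ?_⟩
  rw [eLpNorm_indicator_eq_eLpNorm_restrict hΩ.measurableSet]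
  exact eLpNorm_mono fun x => PiLp.norm_apply_le (f x) j

end Elastodynamics

end

theorem theorem5p2 (R lam μ k₀ : ℝ) (hR : 0 < R) (hμ : 0 < μ) (hlam : -(2 * μ / 3) < lam)
    (hk₀ : 0 < k₀) :
    ∃ C : ℝ, 0 < C ∧
      ∀ Ω : Set Elastodynamics.E3, IsOpen Ω → Ω ⊆ Metric.ball 0 R →
      ∀ k : ℝ, k₀ ≤ k →
      ∀ f : Elastodynamics.E3 → Elastodynamics.C3, MemLp f 2 (volume.restrict Ω) →
        (∀ x ∈ Ω, ∀ i j : Fin 3, IntegrableOn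
          (fun y => Elastodynamics.kupradzeMatrix lam μ k (x - y) i j * f y j) Ω) ∧
        Elastodynamics.MemSobolev 2 Ω (Elastodynamics.newtonPotential lam μ k Ω f) ∧
        ENNReal.ofReal k⁻¹ *
              Elastodynamics.sobolevNorm 2 Ω (Elastodynamics.newtonPotential lam μ k Ω f) +
            Elastodynamics.sobolevNorm 1 Ω (Elastodynamics.newtonPotential lam μ k Ω f) +
            ENNReal.ofReal k *
              eLpNorm (Elastodynamics.newtonPotential lam μ k Ω f) 2 (volume.restrict Ω) ≤
          ENNReal.ofReal C * eLpNorm f 2 (volume.restrict Ω) := by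
  set η : ContDiffBump (0 : ℝ) := ⟨2 * R, 3 * R, by linarith, by linarith⟩
  obtain ⟨C, hC0, hC⟩ := Elastodynamics.exists_fourier_truncKernel_bound η hμ
    (by linarith : 0 < lam + 2 * μ) hk₀
  -- `P` absorbs negative powers of `k` by means of the lower bound `k₀ ≤ k`.
  set P : ℝ := 1 + 1 / k₀ with hP
  have hP1 : 1 ≤ P := by
    have : 0 < 1 / k₀ := by positivity
    linarith
  refine ⟨90 * C * P ^ 2 + 90 * C * P + 9 * C, by positivity, fun Ω hΩ hΩR k hk f hf => ?_⟩
  have hk0 : 0 < k := hk₀.trans_le hk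
  have hPk : 1 ≤ P * k := by
    have : 1 ≤ k / k₀ := (one_le_div hk₀).mpr hk
    have e : P * k = k + k / k₀ := by rw [hP]; ring
    linarith
  set κ₁ : ℝ := k / √(lam + 2 * μ)
  set κ₂ : ℝ := k / √μ
  set K : Fin 3 → Fin 3 → Elastodynamics.E3 → ℂ := Elastodynamics.truncKernel η μ κ₁ κ₂
  set g : Fin 3 → Elastodynamics.E3 → ℂ := fun j => Ω.indicator fun y => f y j
  set F : ℝ≥0∞ := eLpNorm f 2 (volume.restrict Ω)
  set u := Elastodynamics.newtonPotential lam μ k Ω f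
  have hg2 : ∀ j, MemLp (g j) 2 := fun j => (Elastodynamics.memLp_indicator_coord hΩ hf j).1
  have hgF : ∀ j, eLpNorm (g j) 2 volume ≤ F := fun j =>
    (Elastodynamics.memLp_indicator_coord hΩ hf j).2
  have hg : ∀ j, Integrable (g j) := fun j => by
    have hfin : IsFiniteMeasure (volume.restrict Ω) :=
      ⟨by
        rw [Measure.restrict_apply_univ]
        exact (measure_mono hΩR).trans_lt measure_ball_lt_top⟩
    exact (integrable_indicator_iff hΩ.measurableSet).mpr
      ((memLp_piLp_iff.mp hf j).integrable (by norm_num))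
  -- Two points of `Ω` have distance less than `2R`, where the cut-off equals one.
  have hkernel : ∀ x ∈ Ω, ∀ i j, ∀ y ∈ Ω, y ≠ x →
      Elastodynamics.kupradzeMatrix lam μ k (x - y) i j = K i j (x - y) := by
    intro x hx i j y hy hyx
    refine Elastodynamics.kupradzeMatrix_eq_truncKernel η lam μ k i j (sub_ne_zero.mpr hyx.symm) ?_
    have h1 : ‖x‖ < R := by simpa using hΩR hx
    have h2 : ‖y‖ < R := by simpa using hΩR hy
    change ‖x - y‖ < 2 * R
    linarith [norm_sub_le x y]
  have hkernel_ae : ∀ x ∈ Ω, ∀ i j,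
      (fun y => Elastodynamics.kupradzeMatrix lam μ k (x - y) i j * f y j) =ᵐ[volume.restrict Ω]
        fun y => K i j (x - y) * g j y := by
    intro x hx i j
    filter_upwards [ae_restrict_mem hΩ.measurableSet, ae_restrict_of_ae (Measure.ae_ne volume x)]
      with y hy hyx
    rw [hkernel x hx i j y hy hyx, show g j y = f y j from Set.indicator_of_mem hy _]
  have hprod : ∀ x i j, Integrable fun y => K i j (x - y) * g j y := fun x i j => by
    have h1 : MemLp (fun y => K i j (x - y)) 2 :=
      (Elastodynamics.memLp_truncKernel η μ κ₁ κ₂ i j).comp_measurePreserving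
        (Measure.measurePreserving_sub_left volume x)
    exact h1.integrable_mul (hg2 j)
  have hconv : ∀ x ∈ Ω, ∀ i, u x i =
      ∑ j, convolution (K i j) (g j) (ContinuousLinearMap.mul ℂ ℂ) volume x := by
    intro x hx i
    change ∑ j, ∫ y in Ω, Elastodynamics.kupradzeMatrix lam μ k (x - y) i j * f y j = _
    refine Finset.sum_congr rfl fun j _ => ?_
    rw [integral_congr_ae (hkernel_ae x hx i j), convolution_mul_swap]
    exact setIntegral_eq_integral_of_forall_compl_eq_zero fun y hy => by
      rw [show g j y = 0 from Set.indicator_of_notMem hy _, mul_zero]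
  have hweak : ∀ α : Fin 3 → ℕ, ∑ i, α i ≤ 2 → ∃ v, Elastodynamics.HasWeakDeriv Ω α u v ∧
      MemLp v 2 (volume.restrict Ω) ∧ eLpNorm v 2 (volume.restrict Ω) ≤
        9 * (ENNReal.ofReal (C * k ^ (∑ i, α i) / k) * F) := by
    intro α hα
    refine Elastodynamics.exists_hasWeakDeriv_of_convolution hΩ
      (fun i j => Elastodynamics.integrable_truncKernel η μ κ₁ κ₂ i j) hg hg2 hgF hconv α
      fun i j => ?_
    filter_upwards [Measure.ae_ne volume (0 : Elastodynamics.E3)] with ξ hξ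
    exact hC k hk i j _ hα ξ hξ
  have hnorm : ∀ (α : Fin 3 → ℕ) (m : ℕ), ∑ i, α i ≤ m → m ≤ 2 →
      Elastodynamics.weakDerivNorm Ω α u ≤ 9 * (ENNReal.ofReal (C * (P * k) ^ m / k) * F) := by
    intro α m hα hm
    obtain ⟨v, hv, -, hvle⟩ := hweak α (hα.trans hm)
    refine Elastodynamics.weakDerivNorm_le hv (hvle.trans ?_)
    gcongr
    calc k ^ (∑ i, α i) ≤ (P * k) ^ (∑ i, α i) := by
          gcongr
          nlinarith
      _ ≤ (P * k) ^ m := pow_le_pow_right₀ hPk hα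
  refine ⟨fun x hx i j => ?_, fun α hα => ?_, ?_⟩
  · exact ((hprod x i j).integrableOn).congr (hkernel_ae x hx i j).symm
  · obtain ⟨v, hv, hv2, -⟩ := hweak α hα
    exact ⟨v, hv, hv2⟩
  · have hu0 := Elastodynamics.hasWeakDeriv_zero
      (hweak 0 (by simp)).choose_spec.1.1
    have b2 := Elastodynamics.sobolevNorm_le (u := u) le_rfl fun α hα => hnorm α 2 hα le_rfl
    have b1 := Elastodynamics.sobolevNorm_le (u := u) one_le_two
      fun α hα => hnorm α 1 hα one_le_two
    have b0 := hnorm 0 0 (by simp) (by norm_num)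
    rw [hu0.weakDerivNorm_eq hΩ] at b0
    have e90 : ∀ X : ℝ≥0∞, 10 * (9 * X) = ENNReal.ofReal 90 * X := fun X => by
      rw [← mul_assoc]
      norm_num
    have e9 : ∀ X : ℝ≥0∞, 9 * X = ENNReal.ofReal 9 * X := fun X => by norm_num
    rw [e90, ← mul_assoc, ← ENNReal.ofReal_mul (by norm_num)] at b2 b1
    rw [e9, ← mul_assoc, ← ENNReal.ofReal_mul (by norm_num)] at b0
    refine (add_le_add (add_le_add (mul_le_mul_right b2 _) b1) (mul_le_mul_right b0 _)).trans ?_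
    rw [← mul_assoc, ← mul_assoc, ← ENNReal.ofReal_mul (by positivity),
      ← ENNReal.ofReal_mul (by positivity), ← add_mul, ← add_mul,
      ← ENNReal.ofReal_add (by positivity) (by positivity),
      ← ENNReal.ofReal_add (by positivity) (by positivity)]
    refine mul_le_mul_left (ENNReal.ofReal_le_ofReal (le_of_eq ?_)) _
    field_simp
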